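/- Let $A$ and $B$ be unital C$^*$-algebras. The tracial state space $\mathrm{T}(A)$ is the set of bounded linear functionals $\tau$ on $A$ with $\tau(1)=1$, $\tau(a^*a)\ge 0$ and $\tau(ab)=\tau(ba)$ for all $a,b\in A$, with the weak-$*$ topology inherited from $A^*$. For $a,b\in A_+$ write $a\sim_{CP}b$ if there is a sequence $(u_n)$ in $A$ with $a=\sum_n u_n^*u_n$ and $b=\sum_n u_nu_n^*$, both series converging in norm; this is an equivalence relation on $A_+$ that is compatible with addition, and the Cuntz–Pedersen semigroup of $A$ is the quotient $A_+/\!\sim_{CP}$ with the induced addition. The set $A_0=\{a-b: a,b\in A_+,\ a\sim_{CP}b\}$ is a norm-closed real-linear subspace of the self-adjoint part $A_{\mathrm{sa}}$, and $A^q=A_{\mathrm{sa}}/A_0$ is the real Banach space with the quotient norm. The same notation is used for $B$. Suppose that $\mathrm{T}(A)$ and $\mathrm{T}(B)$ are non-empty and that there is an affine homeomorphism from $\mathrm{T}(A)$ onto $\mathrm{T}(B)$. Then $A^q$ and $B^q$ are isomorphic as Banach spaces, i.e. there is a bounded real-linear bijection $A^q\to B^q$ with bounded inverse. If moreover $A$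 and $B$ are simple (nonzero, with no non-trivial closed two-sided ideals), then the Cuntz–Pedersen semigroups $A_+/\!\sim_{CP}$ and $B_+/\!\sim_{CP}$ are isomorphic as additive semigroups. -/

import Mathlib

open Filter Topology
open scoped ComplexOrder

namespace CuntzPedersen

/-- Cuntz–Pedersen equivalence: `a = ∑ uₙ* uₙ` and `b = ∑ uₙ uₙ*` for some sequence `uₙ`, with
convergence in norm (for series of positive elements this is the same as unconditional
convergence, so `HasSum` is the appropriate notion of sum). -/
def CPEquiv {A : Type*} [CStarAlgebra A] (a b : A) : Prop :=
  ∃ u : ℕ → A, HasSum (fun n => star (u n) * u n) a ∧ HasSum (fun n => u n * star (u n)) b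

section Basic

variable {A : Type*} [CStarAlgebra A]

lemma CPEquiv.of_equiv {ι : Type*} (e : ℕ ≃ ι) {a b : A} (u : ι → A)
    (ha : HasSum (fun i => star (u i) * u i) a) (hb : HasSum (fun i => u i * star (u i)) b) :
    CPEquiv a b :=
  ⟨u ∘ e, (e.hasSum_iff (f := fun i => star (u i) * u i)).2 ha,
    (e.hasSum_iff (f := fun i => u i * star (u i))).2 hb⟩

lemma CPEquiv.symm {a b : A} : CPEquiv a b → CPEquiv b a := by
  rintro ⟨u, ha, hb⟩
  exact ⟨fun n => star (u n), by simpa using hb, by simpa using ha⟩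

lemma CPEquiv.add {a b c d : A} : CPEquiv a b → CPEquiv c d → CPEquiv (a + c) (b + d) := by
  rintro ⟨u, ha, hb⟩ ⟨v, hc, hd⟩
  refine CPEquiv.of_equiv Equiv.natSumNatEquivNat.symm (Sum.elim u v) ?_ ?_
  · exact HasSum.sum (f := fun i => star (Sum.elim u v i) * Sum.elim u v i) ha hc
  · exact HasSum.sum (f := fun i => Sum.elim u v i * star (Sum.elim u v i)) hb hd

lemma CPEquiv.smul {a b : A} {r : ℝ} (hr : 0 ≤ r) : CPEquiv a b → CPEquiv (r • a) (r • b) := by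
  rintro ⟨u, ha, hb⟩
  have h : Real.sqrt r * Real.sqrt r = r := Real.mul_self_sqrt hr
  refine ⟨fun n => Real.sqrt r • u n, ?_, ?_⟩
  · simpa [smul_smul, h] using ha.const_smul r
  · simpa [smul_smul, h] using hb.const_smul r

variable [PartialOrder A] [StarOrderedRing A]

lemma CPEquiv.refl {a : A} (ha : 0 ≤ a) : CPEquiv a a := by
  have hs : IsSelfAdjoint (CFC.sqrt a) := .of_nonneg (CFC.sqrt_nonneg a)
  have h := CFC.sqrt_mul_sqrt_self a
  refine ⟨fun n => if n = 0 then CFC.sqrt a else 0, ?_, ?_⟩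
  · convert hasSum_ite_eq (0 : ℕ) a using 2 with n
    by_cases hn : n = 0 <;> simp [hn, hs.star_eq, h]
  · convert hasSum_ite_eq (0 : ℕ) a using 2 with n
    by_cases hn : n = 0 <;> simp [hn, hs.star_eq, h]

lemma CPEquiv.nonneg_left {a b : A} : CPEquiv a b → 0 ≤ a := by
  rintro ⟨u, ha, -⟩
  exact ha.nonneg fun n => star_mul_self_nonneg (u n)

lemma CPEquiv.nonneg_right {a b : A} (h : CPEquiv a b) : 0 ≤ b := h.symm.nonneg_left

/-- Iterated sums of positive elements are sums over the product. -/
lemma hasSum_prod_of_nonneg {ι κ : Type*} {f : ι → κ → A} {g : ι → A} {a : A}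
    (h0 : ∀ i k, 0 ≤ f i k) (hf : ∀ i, HasSum (f i) (g i)) (hg : HasSum g a) :
    HasSum (fun p : ι × κ => f p.1 p.2) a := by
  classical
  have hg0 : ∀ i, 0 ≤ g i := fun i => (hf i).nonneg (h0 i)
  have hle : ∀ (I : Finset ι) (J : Finset κ), ∑ p ∈ I ×ˢ J, f p.1 p.2 ≤ ∑ i ∈ I, g i := by
    intro I J
    rw [Finset.sum_product]
    exact Finset.sum_le_sum fun i _ => sum_le_hasSum J (fun k _ => h0 i k) (hf i)
  have hbd : ∀ F : Finset (ι × κ), ∑ p ∈ F, f p.1 p.2 ≤ a := by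
    intro F
    calc ∑ p ∈ F, f p.1 p.2
        ≤ ∑ p ∈ (F.image Prod.fst) ×ˢ (F.image Prod.snd), f p.1 p.2 := by
          refine Finset.sum_le_sum_of_subset_of_nonneg ?_ fun p _ _ => h0 _ _
          exact Finset.subset_product
      _ ≤ ∑ i ∈ F.image Prod.fst, g i := hle _ _
      _ ≤ a := sum_le_hasSum _ (fun i _ => hg0 i) hg
  rw [HasSum, SummationFilter.unconditional_filter, Metric.tendsto_atTop]
  intro ε hε
  obtain ⟨I, hI⟩ := Metric.tendsto_atTop.1 hg (ε / 2) (half_pos hε)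
  have hJ' : Tendsto (fun J : Finset κ => ∑ i ∈ I, ∑ k ∈ J, f i k) atTop (𝓝 (∑ i ∈ I, g i)) :=
    tendsto_finsetSum _ fun i _ => hf i
  obtain ⟨J, hJ⟩ := Metric.tendsto_atTop.1 hJ' (ε / 2) (half_pos hε)
  refine ⟨I ×ˢ J, fun F hF => ?_⟩
  have h1 : a - ∑ p ∈ F, f p.1 p.2 ≤ a - ∑ p ∈ I ×ˢ J, f p.1 p.2 :=
    sub_le_sub_left (Finset.sum_le_sum_of_subset_of_nonneg hF fun p _ _ => h0 _ _) a
  have h2 := CStarAlgebra.norm_le_norm_of_nonneg_of_le (sub_nonneg.2 (hbd F)) h1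
  rw [dist_comm, dist_eq_norm]
  refine h2.trans_lt ?_
  have h3 := hI I le_rfl
  have h4 := hJ J le_rfl
  rw [Finset.sum_product, ← dist_eq_norm, dist_comm]
  linarith [dist_triangle (∑ i ∈ I, ∑ k ∈ J, f i k) (∑ i ∈ I, g i) a]

/-- Countable sums of Cuntz–Pedersen equivalent elements are equivalent. -/
lemma CPEquiv.hasSum {f g : ℕ → A} {a b : A} (h : ∀ n, CPEquiv (f n) (g n))
    (ha : HasSum f a) (hb : HasSum g b) : CPEquiv a b := by
  choose u hf hg using h
  refine CPEquiv.of_equiv Nat.pairEquiv.symm (fun p : ℕ × ℕ => u p.1 p.2) ?_ ?_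
  · exact hasSum_prod_of_nonneg (f := fun n m => star (u n m) * u n m)
      (fun n m => star_mul_self_nonneg _) hf ha
  · exact hasSum_prod_of_nonneg (f := fun n m => u n m * star (u n m))
      (fun n m => mul_star_self_nonneg _) hg hb

end Basic

section Trans

variable {A : Type*} [CStarAlgebra A]

/-- The function `t ↦ (t + ε)^{-1/2}` (on `t ≥ 0`). -/
noncomputable def invSqrt (ε t : ℝ) : ℝ := (Real.sqrt (|t| + ε))⁻¹

lemma continuous_invSqrt {ε : ℝ} (hε : 0 < ε) : Continuous (invSqrt ε) := by
  unfold invSqrt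
  refine Continuous.inv₀ (by fun_prop) fun t => ?_
  positivity

lemma abs_mul_invSqrt_sub {ε t : ℝ} (hε : 0 < ε) (ht : 0 ≤ t) :
    |t * invSqrt ε t - Real.sqrt t| ≤ Real.sqrt ε := by
  have hp : 0 < Real.sqrt (t + ε) := by positivity
  have h1 : Real.sqrt t ≤ Real.sqrt (t + ε) := Real.sqrt_le_sqrt (by linarith)
  have h2 : Real.sqrt (t + ε) ≤ Real.sqrt t + Real.sqrt ε := by
    refine Real.sqrt_le_iff.2 ⟨by positivity, ?_⟩
    nlinarith [Real.sq_sqrt ht, Real.sq_sqrt hε.le, Real.sqrt_nonneg t, Real.sqrt_nonneg ε,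
      mul_nonneg (Real.sqrt_nonneg t) (Real.sqrt_nonneg ε)]
  have h3 : t * invSqrt ε t = Real.sqrt t * (Real.sqrt t / Real.sqrt (t + ε)) := by
    rw [invSqrt, abs_of_nonneg ht, mul_div_assoc', Real.mul_self_sqrt ht, div_eq_mul_inv]
  have h4 : Real.sqrt t / Real.sqrt (t + ε) ≤ 1 := (div_le_one hp).2 h1
  have h0 := Real.sqrt_nonneg t
  have h5 : Real.sqrt t * (1 - Real.sqrt t / Real.sqrt (t + ε)) ≤
      Real.sqrt (t + ε) * (1 - Real.sqrt t / Real.sqrt (t + ε)) :=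
    mul_le_mul_of_nonneg_right h1 (by linarith)
  have h6 : Real.sqrt (t + ε) * (1 - Real.sqrt t / Real.sqrt (t + ε)) =
      Real.sqrt (t + ε) - Real.sqrt t := by field_simp
  rw [h3, abs_le]
  constructor
  · nlinarith
  · nlinarith [Real.sqrt_nonneg ε]

/-- The approximate inverse square roots of `b`. -/
noncomputable def approxInvSqrt (b : A) (k : ℕ) : A := cfc (invSqrt (1 / ((k : ℝ) + 1))) b

lemma star_approxInvSqrt (b : A) (k : ℕ) : star (approxInvSqrt b k) = approxInvSqrt b k :=
  (cfc_predicate _ b : IsSelfAdjoint (approxInvSqrt b k)).star_eq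

variable [PartialOrder A] [StarOrderedRing A]

lemma norm_mul_cfc_mul_le {b x y : A} (hx : x * star x ≤ b) (hy : star y * y ≤ b)
    {f : ℝ → ℝ} (hf : Continuous f) {c : ℝ} (hc : 0 ≤ c)
    (hfc : ∀ t, 0 ≤ t → |t * f t| ≤ c) : ‖y * cfc f b * x‖ ≤ c := by
  have hb : 0 ≤ b := (mul_star_self_nonneg x).trans hx
  have hbs : IsSelfAdjoint b := .of_nonneg hb
  set D := cfc f b with hD
  have hDs : star D = D := (cfc_predicate f b : IsSelfAdjoint D).star_eq
  set s := CFC.sqrt b with hs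
  have hss : star s = s := (IsSelfAdjoint.of_nonneg (CFC.sqrt_nonneg b)).star_eq
  have hsb : s * s = b := CFC.sqrt_mul_sqrt_self b
  have h1 : ‖y * D * x‖ * ‖y * D * x‖ ≤ ‖s * D * x‖ * ‖s * D * x‖ := by
    rw [← CStarRing.norm_star_mul_self, ← CStarRing.norm_star_mul_self]
    refine CStarAlgebra.norm_le_norm_of_nonneg_of_le (star_mul_self_nonneg _) ?_
    have := star_left_conjugate_le_conjugate hy (D * x)
    rw [← hsb] at this
    simpa [mul_assoc, hss] using this
  have h2 : ‖s * D * x‖ * ‖s * D * x‖ ≤ ‖s * D * s‖ * ‖s * D * s‖ := by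
    rw [← CStarRing.norm_self_mul_star, ← CStarRing.norm_self_mul_star]
    refine CStarAlgebra.norm_le_norm_of_nonneg_of_le (mul_star_self_nonneg _) ?_
    have := star_right_conjugate_le_conjugate hx (s * D)
    rw [← hsb] at this
    simpa [mul_assoc, hss] using this
  have hcomm : Commute D s := by
    have : Commute b D := by
      have := cfc_commute_cfc (fun t : ℝ => t) f b
      rwa [cfc_id' ℝ b] at this
    rw [hs]
    exact (this.cfcₙ_nnreal _).symm
  have h3 : s * D * s = cfc (fun t => t * f t) b := by
    rw [mul_assoc, hcomm.eq, ← mul_assoc, hsb, cfc_mul (fun t => t) f b (by fun_prop)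
      hf.continuousOn, cfc_id' ℝ b]
  have h4 : ‖s * D * s‖ ≤ c := by
    rw [h3]
    refine norm_cfc_le hc fun t ht => hfc t ?_
    exact spectrum_nonneg_of_nonneg hb ht
  have h5 := abs_le_of_sq_le_sq' (a := ‖y * D * x‖) (b := ‖s * D * s‖)
    (by nlinarith) (norm_nonneg _)
  exact h5.2.trans h4

lemma tendsto_sqrt_eps : Tendsto (fun k : ℕ => Real.sqrt (1 / ((k : ℝ) + 1))) atTop (𝓝 0) := by
  simpa using (tendsto_one_div_add_atTop_nhds_zero_nat (𝕜 := ℝ)).sqrt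

lemma exists_tendsto {b x y : A} (hx : x * star x ≤ b) (hy : star y * y ≤ b) :
    ∃ z, Tendsto (fun k => y * approxInvSqrt b k * x) atTop (𝓝 z) := by
  refine cauchySeq_tendsto_of_complete (cauchySeq_of_le_tendsto_0
    (fun N : ℕ => 2 * Real.sqrt (1 / ((N : ℝ) + 1))) ?_ (by simpa using tendsto_sqrt_eps.const_mul 2))
  intro n m N hn hm
  have key : ∀ k : ℕ, N ≤ k → 0 < 1 / ((k : ℝ) + 1) ∧
      Real.sqrt (1 / ((k : ℝ) + 1)) ≤ Real.sqrt (1 / ((N : ℝ) + 1)) := by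
    intro k hk
    refine ⟨by positivity, Real.sqrt_le_sqrt ?_⟩
    gcongr
  obtain ⟨hn0, hn1⟩ := key n hn
  obtain ⟨hm0, hm1⟩ := key m hm
  rw [dist_eq_norm, ← sub_mul, ← mul_sub, approxInvSqrt, approxInvSqrt,
    ← cfc_sub _ _ b (continuous_invSqrt hn0).continuousOn (continuous_invSqrt hm0).continuousOn]
  refine norm_mul_cfc_mul_le hx hy
    ((continuous_invSqrt hn0).sub (continuous_invSqrt hm0)) (by positivity) fun t ht => ?_
  have h1 := abs_le.1 (abs_mul_invSqrt_sub hn0 ht)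
  have h2 := abs_le.1 (abs_mul_invSqrt_sub hm0 ht)
  rw [Pi.sub_apply, mul_sub, abs_le]
  constructor <;> linarith [h1.1, h1.2, h2.1, h2.2]

lemma invSqrt_sq {ε t : ℝ} (hε : 0 < ε) (ht : 0 ≤ t) :
    invSqrt ε t * invSqrt ε t = (t + ε)⁻¹ := by
  rw [invSqrt, ← mul_inv, abs_of_nonneg ht, Real.mul_self_sqrt (by positivity)]

lemma approx_mul_self_mul_approx {b : A} (hb : 0 ≤ b) (k : ℕ) :
    ‖approxInvSqrt b k * b * approxInvSqrt b k‖ ≤ 1 ∧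
      approxInvSqrt b k * b * approxInvSqrt b k =
        1 - (1 / ((k : ℝ) + 1)) • (approxInvSqrt b k * approxInvSqrt b k) := by
  have hbs : IsSelfAdjoint b := .of_nonneg hb
  have hε : 0 < 1 / ((k : ℝ) + 1) := by positivity
  set ε := 1 / ((k : ℝ) + 1) with hεd
  have hc := continuous_invSqrt hε
  have h1 : approxInvSqrt b k * b * approxInvSqrt b k =
      cfc (fun t => invSqrt ε t * t * invSqrt ε t) b := by
    rw [cfc_mul (fun t => invSqrt ε t * t) (invSqrt ε) b (by fun_prop) (by fun_prop),
      cfc_mul (invSqrt ε) (fun t => t) b (by fun_prop) (by fun_prop), cfc_id' ℝ b]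
    rfl
  have h2 : approxInvSqrt b k * approxInvSqrt b k =
      cfc (fun t => invSqrt ε t * invSqrt ε t) b := by
    rw [cfc_mul (invSqrt ε) (invSqrt ε) b (by fun_prop) (by fun_prop)]
    rfl
  constructor
  · rw [h1]
    refine norm_cfc_le zero_le_one fun t ht => ?_
    have ht0 : 0 ≤ t := spectrum_nonneg_of_nonneg hb ht
    rw [mul_right_comm, invSqrt_sq hε ht0, Real.norm_eq_abs, abs_of_nonneg (by positivity),
      inv_mul_le_iff₀ (by positivity)]
    linarith
  · rw [h1, h2, ← cfc_const_mul ε _ b (by fun_prop), ← cfc_one ℝ b,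
      ← cfc_sub _ _ b (by fun_prop) (by fun_prop)]
    refine cfc_congr fun t ht => ?_
    have ht0 : 0 ≤ t := spectrum_nonneg_of_nonneg hb ht
    have : t + ε ≠ 0 := by positivity
    simp only [mul_right_comm _ t, invSqrt_sq hε ht0, Pi.one_apply]
    field_simp
    ring

lemma norm_approx_mul_le {b x : A} (hx : x * star x ≤ b) (k : ℕ) :
    ‖approxInvSqrt b k * x‖ ≤ 1 := by
  have hb : 0 ≤ b := (mul_star_self_nonneg x).trans hx
  have h1 : ‖approxInvSqrt b k * x‖ * ‖approxInvSqrt b k * x‖ ≤ 1 := by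
    rw [← CStarRing.norm_self_mul_star]
    refine le_trans ?_ (approx_mul_self_mul_approx hb k).1
    refine CStarAlgebra.norm_le_norm_of_nonneg_of_le (mul_star_self_nonneg _) ?_
    have := star_right_conjugate_le_conjugate hx (approxInvSqrt b k)
    simpa [mul_assoc, star_approxInvSqrt] using this
  nlinarith [norm_nonneg (approxInvSqrt b k * x)]

lemma hasSum_limits {ι : Type*} {b x : A} {y z : ι → A} (hx : x * star x ≤ b)
    (hy : HasSum (fun m => star (y m) * y m) b)
    (hz : ∀ m, Tendsto (fun k => y m * approxInvSqrt b k * x) atTop (𝓝 (z m))) :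
    HasSum (fun m => star (z m) * z m) (star x * x) := by
  have hb : 0 ≤ b := (mul_star_self_nonneg x).trans hx
  rw [HasSum, tendsto_iff_norm_sub_tendsto_zero]
  have hy' := tendsto_iff_norm_sub_tendsto_zero.1 hy
  refine squeeze_zero (fun _ => norm_nonneg _) (fun F => ?_) hy'
  -- pass to the limit in `k`
  set R := approxInvSqrt b with hR
  have hlim : Tendsto (fun k => ‖∑ m ∈ F, star (y m * R k * x) * (y m * R k * x) - star x * x‖)
      atTop (𝓝 ‖∑ m ∈ F, star (z m) * z m - star x * x‖) := by
    refine ((tendsto_finsetSum _ fun m _ => ?_).sub_const _).norm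
    exact ((hz m).star).mul (hz m)
  have hlim2 : Tendsto (fun k : ℕ => ‖∑ m ∈ F, star (y m) * y m - b‖ + 1 / ((k : ℝ) + 1))
      atTop (𝓝 (‖∑ m ∈ F, star (y m) * y m - b‖ + 0)) :=
    tendsto_const_nhds.add tendsto_one_div_add_atTop_nhds_zero_nat
  rw [add_zero] at hlim2
  refine le_of_tendsto_of_tendsto' hlim hlim2 fun k => ?_
  have hRs : star (R k) = R k := star_approxInvSqrt b k
  have e1 : ∑ m ∈ F, star (y m * R k * x) * (y m * R k * x) - star x * x =
      star (R k * x) * (∑ m ∈ F, star (y m) * y m - b) * (R k * x) -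
        (1 / ((k : ℝ) + 1)) • (star (R k * x) * (R k * x)) := by
    have e2 : star x * (R k * b * R k) * x =
        star x * x - (1 / ((k : ℝ) + 1)) • (star (R k * x) * (R k * x)) := by
      rw [(approx_mul_self_mul_approx hb k).2]
      simp [mul_sub, sub_mul, mul_assoc, hR, star_approxInvSqrt]
    have e3 : star (R k * x) * (∑ m ∈ F, star (y m) * y m - b) * (R k * x) =
        ∑ m ∈ F, star (y m * R k * x) * (y m * R k * x) - star x * (R k * b * R k) * x := by
      rw [mul_sub, sub_mul, Finset.mul_sum, Finset.sum_mul]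
      simp [mul_assoc, hRs]
    rw [e3, e2]
    abel
  rw [e1]
  have hn : ‖R k * x‖ ≤ 1 := norm_approx_mul_le hx k
  have hn' : ‖star (R k * x)‖ ≤ 1 := by rwa [norm_star]
  have hε : 0 ≤ 1 / ((k : ℝ) + 1) := by positivity
  refine (norm_sub_le _ _).trans (add_le_add ?_ ?_)
  · calc _ ≤ ‖star (R k * x)‖ * ‖∑ m ∈ F, star (y m) * y m - b‖ * ‖R k * x‖ := norm_mul₃_le
      _ ≤ 1 * ‖∑ m ∈ F, star (y m) * y m - b‖ * 1 := by gcongr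
      _ = _ := by ring
  · rw [norm_smul, Real.norm_of_nonneg hε, CStarRing.norm_star_mul_self]
    exact mul_le_of_le_one_right hε (mul_le_one₀ hn (norm_nonneg _) hn)

lemma CPEquiv.trans {a b c : A} : CPEquiv a b → CPEquiv b c → CPEquiv a c := by
  rintro ⟨x, ha, hb⟩ ⟨y, hb', hc⟩
  have hx : ∀ n, x n * star (x n) ≤ b := fun n => by
    simpa using sum_le_hasSum {n} (fun m _ => mul_star_self_nonneg (x m)) hb
  have hy : ∀ m, star (y m) * y m ≤ b := fun m => by
    simpa using sum_le_hasSum {m} (fun n _ => star_mul_self_nonneg (y n)) hb'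
  choose z hz using fun n m => exists_tendsto (hx n) (hy m)
  have h1 : ∀ n, HasSum (fun m => star (z n m) * z n m) (star (x n) * x n) := fun n =>
    hasSum_limits (hx n) hb' (hz n)
  have h2 : ∀ m, HasSum (fun n => z n m * star (z n m)) (y m * star (y m)) := fun m => by
    have := hasSum_limits (x := star (y m)) (y := fun n => star (x n)) (z := fun n => star (z n m))
      (b := b) (by simpa using hy m) (by simpa using hb) (fun n => by
        simpa [mul_assoc, star_approxInvSqrt] using (hz n m).star)
    simpa using this
  refine CPEquiv.of_equiv Nat.pairEquiv.symm (fun p : ℕ × ℕ => z p.1 p.2) ?_ ?_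
  · exact hasSum_prod_of_nonneg (f := fun n m => star (z n m) * z n m)
      (fun n m => star_mul_self_nonneg _) h1 ha
  · have := hasSum_prod_of_nonneg (f := fun m n => z n m * star (z n m))
      (fun n m => mul_star_self_nonneg _) h2 hc
    exact (Equiv.prodComm ℕ ℕ).hasSum_iff.1 this

end Trans

section Space

variable (A : Type*) [CStarAlgebra A] [PartialOrder A] [StarOrderedRing A]

/-- The real subspace `A₀ = {a - b : a, b ∈ A₊, a ∼ b}` of the real normed space of self-adjoint
elements of `A`. -/
def nullSpace : Submodule ℝ (selfAdjoint A) where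
  carrier := {x | ∃ a b : A, 0 ≤ a ∧ 0 ≤ b ∧ CPEquiv a b ∧ (x : A) = a - b}
  add_mem' := by
    rintro x y ⟨a, b, ha, hb, hab, hx⟩ ⟨c, d, hc, hd, hcd, hy⟩
    refine ⟨a + c, b + d, add_nonneg ha hc, add_nonneg hb hd, hab.add hcd, ?_⟩
    rw [AddSubgroup.coe_add, hx, hy]
    abel
  zero_mem' := ⟨0, 0, le_rfl, le_rfl, CPEquiv.refl le_rfl, by simp⟩
  smul_mem' := by
    rintro r x ⟨a, b, ha, hb, hab, hx⟩
    rcases le_total 0 r with hr | hr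
    · have h := hab.smul hr
      refine ⟨r • a, r • b, h.nonneg_left, h.nonneg_right, h, ?_⟩
      rw [selfAdjoint.val_smul, hx, smul_sub]
    · have h := (hab.smul (neg_nonneg.2 hr)).symm
      refine ⟨(-r) • b, (-r) • a, h.nonneg_left, h.nonneg_right, h, ?_⟩
      rw [selfAdjoint.val_smul, hx, smul_sub, neg_smul, neg_smul]
      abel

variable {A}

/-- If `x ∈ A₀` then `x₊ + ε ∼ x₋ + ε` for every `ε > 0`. -/
lemma exists_small_of_mem_nullSpace {x : selfAdjoint A} (hx : x ∈ nullSpace A) {ε : ℝ}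
    (hε : 0 < ε) : ∃ a b : A, CPEquiv a b ∧ (x : A) = a - b ∧
      ‖a‖ ≤ ‖(x : A)‖ + ε * ‖(1 : A)‖ ∧ ‖b‖ ≤ ‖(x : A)‖ + ε * ‖(1 : A)‖ := by
  obtain ⟨a, b, ha, hb, hab, hxab⟩ := hx
  have hxs : IsSelfAdjoint (x : A) := x.2
  set p := (x : A)⁺ with hp
  set n := (x : A)⁻ with hn
  have hp0 : 0 ≤ p := CFC.posPart_nonneg _
  have hn0 : 0 ≤ n := CFC.negPart_nonneg _
  have hpn : p - n = x := CFC.posPart_sub_negPart (x : A) hxs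
  -- a common positive summand can be enlarged to a multiple of the unit
  have h1 : CPEquiv (p + b) (n + b) := by
    have e : p + b = n + a := by
      have : p - n = a - b := hpn.trans hxab
      rw [sub_eq_sub_iff_add_eq_add] at this
      rw [this, add_comm]
    have h := (CPEquiv.refl hn0).add hab
    rwa [← e] at h
  have hbs : IsSelfAdjoint b := .of_nonneg hb
  set u : A := algebraMap ℝ A ‖b‖ with hu
  have hbu : 0 ≤ u - b := sub_nonneg.2 hbs.le_algebraMap_norm_self
  have h2 : CPEquiv (p + u) (n + u) := by
    have h := h1.add (CPEquiv.refl hbu)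
    simpa [add_assoc] using h
  have hu0 : 0 ≤ u := by simpa using add_nonneg hbu hb
  have h3 : ∀ m : ℕ, CPEquiv ((m : ℝ) • p + u) ((m : ℝ) • n + u) := by
    intro m
    induction m with
    | zero => simpa using CPEquiv.refl hu0
    | succ m ih =>
      have hm : 0 ≤ (m : ℝ) := m.cast_nonneg
      have e1 := ((CPEquiv.refl hp0).smul hm).add h2
      have e2 := (CPEquiv.refl hn0).add ih
      have e3 : ((m + 1 : ℕ) : ℝ) • p + u = (m : ℝ) • p + (p + u) := by
        push_cast; rw [add_smul, one_smul, add_assoc]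
      have e4 : (m : ℝ) • p + (n + u) = n + ((m : ℝ) • p + u) := by abel
      have e5 : ((m + 1 : ℕ) : ℝ) • n + u = n + ((m : ℝ) • n + u) := by
        push_cast; rw [add_smul, one_smul]; abel
      rw [e3, e5]
      rw [e4] at e1
      exact e1.trans e2
  obtain ⟨m, hm⟩ := exists_nat_gt (‖b‖ / ε)
  have hm0 : 0 < (m : ℝ) := lt_of_le_of_lt (by positivity) hm
  have hsmall : ‖((m : ℝ)⁻¹) • u‖ ≤ ε * ‖(1 : A)‖ := by
    rw [hu, Algebra.algebraMap_eq_smul_one, norm_smul, norm_smul, norm_norm, ← mul_assoc]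
    gcongr
    rw [norm_inv, Real.norm_of_nonneg hm0.le, inv_mul_le_iff₀ hm0]
    rw [div_lt_iff₀ hε] at hm
    exact hm.le
  refine ⟨p + (m : ℝ)⁻¹ • u, n + (m : ℝ)⁻¹ • u, ?_, ?_, ?_, ?_⟩
  · have h := (h3 m).smul (inv_nonneg.2 hm0.le)
    simpa [smul_add, smul_smul, inv_mul_cancel₀ hm0.ne'] using h
  · rw [← hpn]; abel
  · exact (norm_add_le _ _).trans (add_le_add (CStarAlgebra.norm_posPart_le _) hsmall)
  · exact (norm_add_le _ _).trans (add_le_add (CStarAlgebra.norm_negPart_le _) hsmall)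

instance isClosed_nullSpace : IsClosed (nullSpace A : Set (selfAdjoint A)) := by
  rw [← closure_subset_iff_isClosed]
  intro x hx
  have hx' : x ∈ closure ((nullSpace A).toAddSubgroup : Set (selfAdjoint A)) := hx
  obtain ⟨v, hv, hvm, -, hvn⟩ := controlled_sum_of_mem_closure hx'
    (b := fun n => (1 / 2 : ℝ) ^ n) (fun n => by positivity)
  have hgeo : Summable fun n : ℕ => (1 / 2 : ℝ) ^ n := summable_geometric_two
  have hvs : Summable fun n => ‖v n‖ := by
    rw [← summable_nat_add_iff 1]
    exact Summable.of_nonneg_of_le (fun _ => norm_nonneg _)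
      (fun n => (hvn (n + 1) n.succ_pos).le) ((summable_nat_add_iff 1).2 hgeo)
  choose a b hab hvab han hbn using fun n =>
    exists_small_of_mem_nullSpace (hvm n) (ε := (1 / 2 : ℝ) ^ n) (by positivity)
  have hbound : Summable fun n => ‖(v n : A)‖ + (1 / 2 : ℝ) ^ n * ‖(1 : A)‖ :=
    hvs.add (hgeo.mul_right _)
  have ha : Summable a := Summable.of_norm_bounded hbound han
  have hb : Summable b := Summable.of_norm_bounded hbound hbn
  have h := CPEquiv.hasSum hab ha.hasSum hb.hasSum
  refine ⟨_, _, h.nonneg_left, h.nonneg_right, h, ?_⟩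
  have h1 : Tendsto (fun n => ∑ i ∈ Finset.range (n + 1), (v i : A)) atTop (𝓝 (x : A)) := by
    have := (continuous_subtype_val.tendsto x).comp hv
    refine this.congr fun n => ?_
    simp
  have h2 := (ha.hasSum.sub hb.hasSum).tendsto_sum_nat.comp (tendsto_add_atTop_nat 1)
  refine tendsto_nhds_unique h1 (h2.congr fun n => ?_)
  exact Finset.sum_congr rfl fun i _ => (hvab i).symm

instance completeSpace_selfAdjoint {A : Type*} [CStarAlgebra A] :
    CompleteSpace (selfAdjoint A) :=
  (isClosed_eq continuous_star continuous_id : IsClosed {x : A | star x = x}).completeSpace_coe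

/-- The real Banach space `A^q = A_sa / A₀`, with the quotient norm. The quotient norm is a norm
because `A₀` is closed. -/
abbrev TraceQuotient (A : Type*) [CStarAlgebra A] [PartialOrder A] [StarOrderedRing A] : Type _ :=
  selfAdjoint A ⧸ nullSpace A

variable (A)

/-- Cuntz–Pedersen equivalence as an additive congruence on the positive cone `A₊`. -/
def cpCon : AddCon {a : A // 0 ≤ a} where
  r a b := CPEquiv (a : A) (b : A)
  iseqv := ⟨fun a => CPEquiv.refl a.2, fun h => h.symm, fun h h' => h.trans h'⟩
  add' h h' := h.add h'

/-- The Cuntz–Pedersen semigroup `A₊ / ∼`, with addition induced by that of `A₊`. -/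
abbrev CPSemigroup : Type _ := (cpCon A).Quotient

end Space

section Traces

variable (A : Type*) [CStarAlgebra A]

/-- The tracial state space of a unital C*-algebra, as a subset of the dual space with its
weak-* topology. -/
def tracialStates : Set (WeakDual ℂ A) :=
  {τ | τ 1 = 1 ∧ (∀ a : A, 0 ≤ τ (star a * a)) ∧ ∀ a b : A, τ (a * b) = τ (b * a)}

/-- A C*-algebra is simple if it is nonzero and has no closed two-sided ideals besides `0` and
itself. -/
def IsSimpleCStarAlgebra : Prop :=
  Nontrivial A ∧ ∀ I : TwoSidedIdeal A, IsClosed (I : Set A) → I = ⊥ ∨ I = ⊤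

end Traces

/-- A homeomorphism between two (convex) subsets of real topological vector spaces is affine if
it preserves all convex combinations of two points. -/
def IsAffineHomeo {E F : Type*} [AddCommGroup E] [Module ℝ E] [TopologicalSpace E]
    [AddCommGroup F] [Module ℝ F] [TopologicalSpace F] {K : Set E} {L : Set F} (e : K ≃ₜ L) :
    Prop :=
  ∀ (x y z : K) (s t : ℝ), 0 ≤ s → 0 ≤ t → s + t = 1 →
    (z : E) = s • (x : E) + t • (y : E) → (e z : F) = s • (e x : F) + t • (e y : F)

end CuntzPedersen

/-! Both invariants are recovered from the affine topology of the tracial state space. Evaluation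
sends `A^q` into the continuous affine functions on `T(A)`, and for nonempty `T(A)` this is an
isometric isomorphism onto them with the sup norm. An affine homeomorphism then carries one function
space to the other (`exists_linearIsometryEquiv`), which yields more than the bounded isomorphism
required.

The isometry has two halves. By Hahn–Banach, an element strictly positive on all traces is positive
modulo `A₀` (`exists_nonneg_sub_mem_nullSpace`). Riesz decomposition (`CPEquiv.exists_add_eq`) turns
two-sided order bounds modulo `A₀` into bounds on an actual representative, so the quotient norm is
the sup norm (`norm_le_of_abs_quotientTrace_le`). Surjectivity follows by separating the graphs of
`f` and `f + ε`, then using completeness (`exists_quotientTrace_eq`).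

If `A` is simple, each nonzero positive element is equivalent to one that splits off a small
multiple of the unit. That unit absorbs the gap between congruence modulo `A₀` and equivalence, so
the semigroup embeds in `A^q` (`IsSimpleCStarAlgebra.cpEquiv_of_sub_mem`). Its image, zero together
with the elements strictly positive on all traces, is described by traces alone and is therefore
preserved by the isometry. -/

namespace CuntzPedersen

/-! ### Equivalence modulo `A₀` and Riesz decomposition -/

section Decomposition

variable {A : Type*} [CStarAlgebra A]

lemma cpEquiv_star_mul_self (x : A) : CPEquiv (star x * x) (x * star x) := by
  refine ⟨fun n => if n = 0 then x else 0, ?_, ?_⟩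
  · convert hasSum_ite_eq (0 : ℕ) (star x * x) using 2 with n
    by_cases hn : n = 0 <;> simp [hn]
  · convert hasSum_ite_eq (0 : ℕ) (x * star x) using 2 with n
    by_cases hn : n = 0 <;> simp [hn]

variable [PartialOrder A] [StarOrderedRing A]

/-- Elements with the same class modulo `A₀` become equivalent after adding any positive
multiple of the unit. -/
lemma CPEquiv.add_algebraMap_of_sub_mem {p n : A} (hp : 0 ≤ p) (hn : 0 ≤ n)
    {x : selfAdjoint A} (hx : x ∈ nullSpace A) (hpn : (x : A) = p - n) {ε : ℝ} (hε : 0 < ε) :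
    CPEquiv (p + algebraMap ℝ A ε) (n + algebraMap ℝ A ε) := by
  obtain ⟨a, b, ha, hb, hab, hxab⟩ := hx
  have h1 : CPEquiv (p + b) (n + b) := by
    have e : p + b = n + a := by
      have : p - n = a - b := hpn.symm.trans hxab
      rw [sub_eq_sub_iff_add_eq_add] at this
      rw [this, add_comm]
    have h := (CPEquiv.refl hn).add hab
    rwa [← e] at h
  -- With `m * ε` above `‖b‖`, the summand `b` can be enlarged to `m * ε` times the unit; dividing
  -- by `m` at the end leaves exactly `ε`.
  obtain ⟨m, hm⟩ := exists_nat_gt (‖b‖ / ε)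
  have hm0 : 0 < (m : ℝ) := lt_of_le_of_lt (by positivity) hm
  set u : A := algebraMap ℝ A (m * ε) with hu
  have hbu : 0 ≤ u - b := by
    refine sub_nonneg.2 ((IsSelfAdjoint.of_nonneg hb).le_algebraMap_norm_self.trans ?_)
    rw [hu, ← sub_nonneg, ← map_sub]
    refine algebraMap_nonneg A ?_
    rw [div_lt_iff₀ hε] at hm
    linarith
  have h2 : CPEquiv (p + u) (n + u) := by
    have h := h1.add (CPEquiv.refl hbu)
    simpa [add_assoc] using h
  have hu0 : 0 ≤ u := by simpa using add_nonneg hbu hb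
  -- The same `u` acts as a catalyst: copies of `p` are exchanged for copies of `n` one at a time,
  -- so `u` does not grow with `m`.
  have h3 : ∀ m : ℕ, CPEquiv ((m : ℝ) • p + u) ((m : ℝ) • n + u) := by
    intro m
    induction m with
    | zero => simpa using CPEquiv.refl hu0
    | succ m ih =>
      have hm : 0 ≤ (m : ℝ) := m.cast_nonneg
      have e1 := ((CPEquiv.refl hp).smul hm).add h2
      have e2 := (CPEquiv.refl hn).add ih
      have e3 : ((m + 1 : ℕ) : ℝ) • p + u = (m : ℝ) • p + (p + u) := by
        push_cast; rw [add_smul, one_smul, add_assoc]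
      have e4 : (m : ℝ) • p + (n + u) = n + ((m : ℝ) • p + u) := by abel
      have e5 : ((m + 1 : ℕ) : ℝ) • n + u = n + ((m : ℝ) • n + u) := by
        push_cast; rw [add_smul, one_smul]; abel
      rw [e3, e5]
      rw [e4] at e1
      exact e1.trans e2
  have h := (h3 m).smul (inv_nonneg.2 hm0.le)
  have hu' : (m : ℝ)⁻¹ • u = algebraMap ℝ A ε := by
    rw [hu, Algebra.algebraMap_eq_smul_one, Algebra.algebraMap_eq_smul_one, smul_smul,
      inv_mul_cancel_left₀ hm0.ne']
  simpa [smul_add, smul_smul, inv_mul_cancel₀ hm0.ne', hu'] using h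

/-- The norm is monotone on positive elements, so the Cauchy criterion passes from `g` to `f`. -/
lemma summable_of_nonneg_of_le {ι : Type*} {f g : ι → A} (hf : ∀ i, 0 ≤ f i)
    (hfg : ∀ i, f i ≤ g i) (hg : Summable g) : Summable f := by
  rw [summable_iff_vanishing_norm] at hg ⊢
  intro ε hε
  obtain ⟨s, hs⟩ := hg ε hε
  refine ⟨s, fun t ht => lt_of_le_of_lt ?_ (hs t ht)⟩
  exact CStarAlgebra.norm_le_norm_of_nonneg_of_le (Finset.sum_nonneg fun i _ => hf i)
    (Finset.sum_le_sum fun i _ => hfg i)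

/-- Riesz decomposition for Cuntz–Pedersen equivalence. -/
lemma CPEquiv.exists_add_eq {h k c : A} (hh : 0 ≤ h) (hk : 0 ≤ k) (hc : CPEquiv (h + k) c) :
    ∃ h' k' : A, CPEquiv h h' ∧ CPEquiv k k' ∧ c = h' + k' := by
  obtain ⟨y, hy, hyc⟩ := hc
  set x : Bool → A := fun i => cond i (CFC.sqrt h) (CFC.sqrt k) with hx
  have hxs : ∀ i, star (x i) = x i := by
    rintro (_ | _)
    exacts [(IsSelfAdjoint.of_nonneg (CFC.sqrt_nonneg k)).star_eq,
      (IsSelfAdjoint.of_nonneg (CFC.sqrt_nonneg h)).star_eq]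
  have hxx : ∀ i, x i * x i = cond i h k := by
    rintro (_ | _)
    exacts [CFC.sqrt_mul_sqrt_self k, CFC.sqrt_mul_sqrt_self h]
  have hxb : ∀ i, x i * star (x i) ≤ h + k := by
    rintro (_ | _) <;> rw [hxs, hxx] <;> simpa
  have hyb : ∀ m, star (y m) * y m ≤ h + k := fun m => by
    simpa using sum_le_hasSum {m} (fun n _ => star_mul_self_nonneg (y n)) hy
  have hxsum : HasSum (fun i => x i * star (x i)) (h + k) := by
    have := hasSum_fintype fun i => x i * star (x i)
    simpa [hxs, hxx] using this
  -- Formally `z i m` is `y m * (h + k)^(-1/2) * x i`. This array refines both factorisations of `h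
  -- + k`: summing `star z * z` over `m` recovers `h` or `k`, and summing `z * star z` over `i`
  -- recovers `y m * star (y m)`.
  choose z hz using fun i m => exists_tendsto (hxb i) (hyb m)
  have h1 : ∀ i, HasSum (fun m => star (z i m) * z i m) (star (x i) * x i) := fun i =>
    hasSum_limits (hxb i) hy (hz i)
  have h2 : ∀ m, HasSum (fun i => z i m * star (z i m)) (y m * star (y m)) := fun m => by
    have := hasSum_limits (x := star (y m)) (y := fun n => star (x n)) (z := fun n => star (z n m))
      (b := h + k) (by simpa using hyb m) (by simpa using hxsum) (fun n => by
        simpa [mul_assoc, star_approxInvSqrt] using (hz n m).star)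
    simpa using this
  have h3 : ∀ m, z true m * star (z true m) + z false m * star (z false m) =
      y m * star (y m) := fun m => by
    simpa using (hasSum_fintype _).unique (h2 m)
  have h4 : ∀ i, Summable fun m => z i m * star (z i m) := fun i => by
    refine summable_of_nonneg_of_le (fun m => mul_star_self_nonneg _) (fun m => ?_) hyc.summable
    rw [← h3 m]
    cases i <;> simp [mul_star_self_nonneg]
  refine ⟨_, _, ⟨z true, ?_, (h4 true).hasSum⟩, ⟨z false, ?_, (h4 false).hasSum⟩, ?_⟩
  · simpa [hxs, hxx] using h1 true
  · simpa [hxs, hxx] using h1 false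
  · refine hyc.unique ?_
    simpa only [h3] using (h4 true).hasSum.add (h4 false).hasSum

lemma CPEquiv.sub_mem_nullSpace {a b : A} (h : CPEquiv a b) (x : selfAdjoint A)
    (hx : (x : A) = a - b) : x ∈ nullSpace A :=
  ⟨a, b, h.nonneg_left, h.nonneg_right, h, hx⟩

end Decomposition

/-! ### Tracial states as real functionals -/

section TracialStates

open scoped ComplexStarModule

variable {A : Type*} [CStarAlgebra A]

lemma ext_of_selfAdjoint {σ τ : WeakDual ℂ A} (h : ∀ x : selfAdjoint A, σ x = τ x) : σ = τ := by
  refine ContinuousLinearMap.ext fun a => ?_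
  have h1 : σ ((ℜ a : A) + Complex.I • (ℑ a : A)) = τ ((ℜ a : A) + Complex.I • (ℑ a : A)) := by
    rw [map_add, map_add, map_smul, map_smul, h, h]
  rwa [realPart_add_I_smul_imaginaryPart] at h1

lemma convex_tracialStates : Convex ℝ (tracialStates A) := by
  rintro σ ⟨hσ1, hσp, hσt⟩ τ ⟨hτ1, hτp, hτt⟩ s t hs ht hst
  have e : ∀ a, (s • σ + t • τ) a = (s : ℂ) * σ a + (t : ℂ) * τ a := fun a => rfl
  refine ⟨?_, fun a => ?_, fun a b => ?_⟩
  · rw [e, hσ1, hτ1, mul_one, mul_one]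
    exact_mod_cast hst
  · rw [e]
    exact add_nonneg (mul_nonneg (by exact_mod_cast hs) (hσp a))
      (mul_nonneg (by exact_mod_cast ht) (hτp a))
  · rw [e, e, hσt, hτt]

lemma apply_algebraMap_of_mem_tracialStates {τ : WeakDual ℂ A} (hτ : τ ∈ tracialStates A)
    (r : ℝ) : τ (algebraMap ℝ A r) = r := by
  have : algebraMap ℝ A r = (r : ℂ) • (1 : A) := by
    rw [Algebra.algebraMap_eq_smul_one, Complex.coe_smul]
  rw [this, map_smul, hτ.1, smul_eq_mul, mul_one]

lemma apply_eq_of_cpEquiv {τ : WeakDual ℂ A} (hτ : τ ∈ tracialStates A) {a b : A}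
    (hab : CPEquiv a b) : τ a = τ b := by
  obtain ⟨u, ha, hb⟩ := hab
  have h1 := ha.map τ (map_continuous τ)
  have h2 := hb.map τ (map_continuous τ)
  have e : (τ ∘ fun n => star (u n) * u n) = τ ∘ fun n => u n * star (u n) :=
    funext fun n => hτ.2.2 _ _
  rw [e] at h1
  exact h1.unique h2

/-- The real functional on self-adjoint elements given by a tracial state. -/
noncomputable def realTrace (τ : tracialStates A) : selfAdjoint A →ₗ[ℝ] ℝ where
  toFun x := ((τ : WeakDual ℂ A) x).re
  map_add' x y := by simp
  map_smul' r x := by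
    rw [selfAdjoint.val_smul, ← Complex.coe_smul, map_smul]
    simp

lemma realTrace_apply (τ : tracialStates A) (x : selfAdjoint A) :
    realTrace τ x = ((τ : WeakDual ℂ A) x).re := rfl

variable [PartialOrder A] [StarOrderedRing A]

lemma apply_nonneg_of_mem_tracialStates {τ : WeakDual ℂ A} (hτ : τ ∈ tracialStates A) {a : A}
    (ha : 0 ≤ a) : 0 ≤ τ a := by
  have h := hτ.2.1 (CFC.sqrt a)
  rwa [(IsSelfAdjoint.of_nonneg (CFC.sqrt_nonneg a)).star_eq, CFC.sqrt_mul_sqrt_self a] at h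

lemma apply_mono_of_mem_tracialStates {τ : WeakDual ℂ A} (hτ : τ ∈ tracialStates A) {a b : A}
    (hab : a ≤ b) : τ a ≤ τ b := by
  have h := apply_nonneg_of_mem_tracialStates hτ (sub_nonneg.2 hab)
  rwa [map_sub, sub_nonneg] at h

lemma neg_algebraMap_norm_le_coe (x : selfAdjoint A) : -algebraMap ℝ A ‖x‖ ≤ x :=
  x.2.neg_algebraMap_norm_le_self

lemma coe_le_algebraMap_norm (x : selfAdjoint A) : (x : A) ≤ algebraMap ℝ A ‖x‖ :=
  x.2.le_algebraMap_norm_self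

lemma abs_realTrace_le (τ : tracialStates A) (x : selfAdjoint A) : |realTrace τ x| ≤ ‖x‖ := by
  have h1 := apply_mono_of_mem_tracialStates τ.2 (neg_algebraMap_norm_le_coe x)
  have h2 := apply_mono_of_mem_tracialStates τ.2 (coe_le_algebraMap_norm x)
  rw [map_neg, apply_algebraMap_of_mem_tracialStates τ.2] at h1
  rw [apply_algebraMap_of_mem_tracialStates τ.2] at h2
  rw [realTrace_apply, abs_le]
  exact ⟨by simpa using (Complex.le_def.1 h1).1, by simpa using (Complex.le_def.1 h2).1⟩

/-- In the order of `ℂ`, lying below a real number forces the imaginary part to vanish. -/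
lemma coe_realTrace (τ : tracialStates A) (x : selfAdjoint A) :
    (realTrace τ x : ℂ) = (τ : WeakDual ℂ A) x := by
  have h := apply_mono_of_mem_tracialStates τ.2 (coe_le_algebraMap_norm x)
  rw [apply_algebraMap_of_mem_tracialStates τ.2] at h
  refine Complex.ext rfl ?_
  simpa using (Complex.le_def.1 h).2.symm

lemma realTrace_injective : Function.Injective (realTrace : tracialStates A → _) := by
  intro σ τ h
  refine Subtype.ext (ext_of_selfAdjoint fun x => ?_)
  rw [← coe_realTrace, ← coe_realTrace, h]

lemma realTrace_eq_zero_of_mem {x : selfAdjoint A} (hx : x ∈ nullSpace A) (τ : tracialStates A) :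
    realTrace τ x = 0 := by
  obtain ⟨a, b, -, -, hab, hx⟩ := hx
  rw [realTrace_apply, hx, map_sub, apply_eq_of_cpEquiv τ.2 hab, sub_self, Complex.zero_re]

/-- The real functional on `A^q` given by a tracial state. -/
noncomputable def quotientTrace (τ : tracialStates A) : TraceQuotient A →ₗ[ℝ] ℝ :=
  (nullSpace A).liftQ (realTrace τ) fun _ hx => realTrace_eq_zero_of_mem hx τ

lemma abs_quotientTrace_le (τ : tracialStates A) (x : TraceQuotient A) :
    |quotientTrace τ x| ≤ ‖x‖ := by
  refine le_of_forall_pos_le_add fun ε hε => ?_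
  obtain ⟨y, rfl, hy⟩ := Submodule.Quotient.norm_mk_lt x hε
  exact (abs_realTrace_le τ y).trans hy.le

/-- A positive normalised functional on the self-adjoint part that vanishes on `A₀` comes from a
tracial state. -/
lemma exists_tracialState_of_functional (φ : selfAdjoint A →L[ℝ] ℝ)
    (hpos : ∀ x : selfAdjoint A, 0 ≤ (x : A) → 0 ≤ φ x) (h1 : φ 1 = 1)
    (h0 : ∀ x ∈ nullSpace A, φ x = 0) :
    ∃ τ : tracialStates A, ∀ x : selfAdjoint A, realTrace τ x = φ x := by
  -- `φ` is extended to `A` through the real part and then complexified; the result agrees with `φ`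
  -- on self-adjoint elements.
  set ρ : A →L[ℝ] selfAdjoint A := LinearMap.mkContinuous realPart 1 fun x => by
    simpa using realPart.norm_le x
  have hρ : ∀ a, ρ a = ℜ a := fun _ => rfl
  set f : StrongDual ℝ A := φ.comp ρ with hf
  set T : StrongDual ℂ A := f.extendRCLike with hT
  have hTa : ∀ a, T a = φ (ℜ a) + Complex.I * φ (ℑ a) := fun a => by
    rw [hT, StrongDual.extendRCLike_apply]
    simp [hf, hρ, realPart_I_smul]
  have hTs : ∀ x : selfAdjoint A, T x = φ x := fun x => by
    rw [hTa, selfAdjoint.realPart_coe, selfAdjoint.imaginaryPart_coe]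
    simp
  have hdiag : ∀ x : A, T (star x * x) = T (x * star x) := fun x => by
    set y : selfAdjoint A := ⟨star x * x, .star_mul_self x⟩ - ⟨x * star x, .mul_star_self x⟩
    have hy : (y : A) = star x * x - x * star x := rfl
    have h := hTs y
    rw [h0 y ((cpEquiv_star_mul_self x).sub_mem_nullSpace y hy), hy, map_sub] at h
    exact sub_eq_zero.1 (by simpa using h)
  refine ⟨⟨StrongDual.toWeakDual T, ?_, fun a => ?_, fun a b => ?_⟩, fun x => ?_⟩
  · have h := hTs 1
    rw [h1] at h
    simpa using h
  · have h := hTs ⟨star a * a, .star_mul_self a⟩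
    have h' := hpos ⟨star a * a, .star_mul_self a⟩ (star_mul_self_nonneg a)
    change 0 ≤ T (star a * a)
    rw [h]
    exact_mod_cast h'
  · change T (a * b) = T (b * a)
    -- Polarisation: the first two identities give the sum and the difference of the commutator
    -- terms for `a, b` and for their adjoints; combining them isolates `2i (T(ab) - T(ba))`.
    have e1 := hdiag (star a + b)
    have e2 := hdiag (star a + Complex.I • b)
    have e3 := hdiag (star a)
    have e4 := hdiag b
    simp only [star_add, star_star, star_smul, add_mul, mul_add, map_add, smul_mul_assoc,
      mul_smul_comm, map_smul, smul_eq_mul, Complex.star_def, Complex.conj_I] at e1 e2 e3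
    have e5 : Complex.I * Complex.I = -1 := Complex.I_mul_I
    have h2 : (2 : ℂ) * Complex.I ≠ 0 := by simp
    refine mul_left_cancel₀ h2 ?_
    linear_combination Complex.I * e1 + e2 - (1 + Complex.I) * e3 - (1 + Complex.I) * e4
      - (T (b * star b) - T (star b * b)) * e5
  · change (T x).re = φ x
    rw [hTs x, Complex.ofReal_re]

end TracialStates

/-! ### The quotient norm as a supremum over traces -/

section Norm

variable {A : Type*} [CStarAlgebra A] [PartialOrder A] [StarOrderedRing A]

/-- A self-adjoint element that is strictly positive on all tracial states is positive
modulo `A₀`. -/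
lemma exists_nonneg_sub_mem_nullSpace {x : selfAdjoint A} (hx : ∀ τ, 0 < realTrace τ x) :
    ∃ a : selfAdjoint A, 0 ≤ (a : A) ∧ x - a ∈ nullSpace A := by
  set C : Set (selfAdjoint A) := {y | ∃ a : selfAdjoint A, 0 ≤ (a : A) ∧ y - a ∈ nullSpace A}
    with hC
  have hCconv : Convex ℝ C := by
    rintro y ⟨a, ha, hya⟩ z ⟨b, hb, hzb⟩ s t hs ht -
    refine ⟨s • a + t • b, ?_, ?_⟩
    · rw [AddSubgroup.coe_add, selfAdjoint.val_smul, selfAdjoint.val_smul]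
      exact add_nonneg (smul_nonneg hs ha) (smul_nonneg ht hb)
    · have := (nullSpace A).add_mem ((nullSpace A).smul_mem s hya) ((nullSpace A).smul_mem t hzb)
      convert this using 1
      rw [smul_sub, smul_sub]
      abel
  -- The unit is an order unit, so moving any point of the cone `C = A₊ + A₀` by a positive multiple
  -- of it lands in the interior. Hence open-set separation applies.
  have hball : ∀ c ∈ C, ∀ r : ℝ, 0 < r → c + r • (1 : selfAdjoint A) ∈ interior C := by
    rintro c ⟨a, ha, hca⟩ r hr
    rw [mem_interior]
    refine ⟨Metric.ball (c + r • 1) r, fun y hy => ?_, Metric.isOpen_ball,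
      Metric.mem_ball_self hr⟩
    rw [mem_ball_iff_norm] at hy
    refine ⟨a + (r • 1 + (y - (c + r • 1))), ?_, ?_⟩
    · rw [AddSubgroup.coe_add]
      refine add_nonneg ha ?_
      have h := neg_algebraMap_norm_le_coe (y - (c + r • 1))
      have h' : algebraMap ℝ A ‖y - (c + r • 1)‖ ≤ algebraMap ℝ A r := by
        rw [← sub_nonneg, ← map_sub]
        exact algebraMap_nonneg A (sub_nonneg.2 hy.le)
      rw [AddSubgroup.coe_add, selfAdjoint.val_smul, selfAdjoint.val_one,
        ← Algebra.algebraMap_eq_smul_one]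
      have := add_le_add h' h
      rwa [add_neg_cancel] at this
    · convert hca using 1
      abel
  have hnull : ∀ y ∈ nullSpace A, y ∈ C := fun y hy => ⟨0, le_rfl, by simpa using hy⟩
  have hpos : ∀ y : selfAdjoint A, 0 ≤ (y : A) → y ∈ C := fun y hy =>
    ⟨y, hy, by simp⟩
  by_contra hxC
  obtain ⟨f, hf⟩ := geometric_hahn_banach_open_point hCconv.interior isOpen_interior
    (fun h => hxC (show x ∈ C from interior_subset h) : x ∉ interior C)
  have hf' : ∀ c ∈ C, ∀ r : ℝ, 0 < r → f c + r * f 1 < f x := fun c hc r hr => by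
    simpa using hf _ (hball c hc r hr)
  have hlim : ∀ c ∈ C, f c ≤ f x := fun c hc => by
    have h : Tendsto (fun r : ℝ => f c + r * f 1) (𝓝[>] 0) (𝓝 (f c + 0 * f 1)) :=
      ((continuous_const.add (continuous_id.mul continuous_const)).tendsto 0).mono_left
        nhdsWithin_le_nhds
    rw [zero_mul, add_zero] at h
    refine le_of_tendsto h ?_
    filter_upwards [self_mem_nhdsWithin] with r hr using (hf' c hc r hr).le
  have hsmul : ∀ c ∈ C, ∀ r : ℝ, 0 ≤ r → r • c ∈ C := by
    rintro c ⟨a, ha, hca⟩ r hr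
    refine ⟨r • a, ?_, ?_⟩
    · rw [selfAdjoint.val_smul]
      exact smul_nonneg hr ha
    · rw [← smul_sub]
      exact (nullSpace A).smul_mem r hca
  have hx0 : 0 ≤ f x := by simpa using hlim 0 (hnull 0 (zero_mem _))
  -- A functional bounded above on a cone is nonpositive there.
  have hneg : ∀ c ∈ C, f c ≤ 0 := fun c hc => by
    by_contra! h
    have := hlim _ (hsmul c hc ((f x + 1) / f c) (by positivity))
    rw [map_smul, smul_eq_mul, div_mul_cancel₀ _ h.ne'] at this
    linarith
  have h0 : ∀ y ∈ nullSpace A, f y = 0 := fun y hy => by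
    refine le_antisymm (hneg y (hnull y hy)) ?_
    have := hneg (-y) (hnull _ (neg_mem hy))
    rw [map_neg] at this
    linarith
  -- If `f 1 = 0`, the order unit forces `f ≥ 0` everywhere, hence `f x ≤ 0`; strict separation at
  -- the interior point `1` says `0 < f x`.
  have h1 : f 1 < 0 := by
    refine lt_of_le_of_ne (hneg 1 (hpos 1 (by simp))) fun h1 => ?_
    have hz : ∀ y : selfAdjoint A, 0 ≤ f y := fun y => by
      have h := hneg (‖y‖ • (1 : selfAdjoint A) - y) (hpos _ (by
        rw [AddSubgroup.coe_sub, selfAdjoint.val_smul, selfAdjoint.val_one,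
          ← Algebra.algebraMap_eq_smul_one]
        exact sub_nonneg.2 (coe_le_algebraMap_norm y)))
      rw [map_sub, map_smul, h1, smul_zero] at h
      linarith
    have h2 := hf' 0 (hnull 0 (zero_mem _)) 1 one_pos
    have h3 := hz (-x)
    rw [map_neg] at h3
    rw [h1, map_zero] at h2
    linarith
  -- Dividing by the negative number `f 1` makes `f` a tracial state, whose value at `x` is
  -- nonpositive.
  obtain ⟨τ, hτ⟩ := exists_tracialState_of_functional ((f 1)⁻¹ • f)
    (fun y hy => mul_nonneg_of_nonpos_of_nonpos (inv_nonpos.2 h1.le) (hneg y (hpos y hy)))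
    (inv_mul_cancel₀ h1.ne) (fun y hy => by simp [h0 y hy])
  have h2 := hx τ
  rw [hτ x] at h2
  exact absurd (mul_nonpos_of_nonpos_of_nonneg (inv_nonpos.2 h1.le) hx0) (not_le.2 h2)

/-- The order bounds confine the spectrum to `[-r, r]`, and the spectrum contains `‖x‖` or `-‖x‖`.
-/
lemma norm_le_of_algebraMap_le {x : A} (hx : IsSelfAdjoint x) {r : ℝ} (hr : 0 ≤ r)
    (h1 : -algebraMap ℝ A r ≤ x) (h2 : x ≤ algebraMap ℝ A r) : ‖x‖ ≤ r := by
  rcases subsingleton_or_nontrivial A with _ | _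
  · rwa [Subsingleton.elim x 0, norm_zero]
  have hb : ∀ t ∈ spectrum ℝ x, |t| ≤ r := fun t ht => by
    rw [← map_neg, algebraMap_le_iff_le_spectrum] at h1
    rw [le_algebraMap_iff_spectrum_le] at h2
    exact abs_le.2 ⟨h1 t ht, h2 t ht⟩
  rcases CStarAlgebra.norm_or_neg_norm_mem_spectrum hx with h | h
  · simpa using hb _ h
  · simpa using hb _ h

/-- The quotient norm of `A^q` is bounded by the supremum over the tracial states. -/
lemma norm_le_of_abs_quotientTrace_le {x : TraceQuotient A} {t : ℝ} (ht : 0 ≤ t)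
    (hx : ∀ τ, |quotientTrace τ x| ≤ t) : ‖x‖ ≤ t := by
  refine le_of_forall_pos_le_add fun ε hε => ?_
  obtain ⟨y, rfl⟩ := Submodule.Quotient.mk_surjective _ x
  -- One half of `ε` makes `s ± y` strictly positive on traces; the other pays for passing from
  -- congruence to equivalence.
  set s := t + ε / 2 with hs
  have hst : t < s := by linarith
  have hone : ∀ τ : tracialStates A, realTrace τ 1 = 1 := fun τ => by
    rw [realTrace_apply, selfAdjoint.val_one, τ.2.1, Complex.one_re]
  have hy : ∀ τ, |realTrace τ y| ≤ t := hx
  obtain ⟨a, ha, hya⟩ := exists_nonneg_sub_mem_nullSpace (x := s • 1 + y) fun τ => by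
    rw [map_add, map_smul, hone, smul_eq_mul, mul_one]
    linarith [(abs_le.1 (hy τ)).1]
  obtain ⟨b, hb, hyb⟩ := exists_nonneg_sub_mem_nullSpace (x := s • 1 - y) fun τ => by
    rw [map_sub, map_smul, hone, smul_eq_mul, mul_one]
    linarith [(abs_le.1 (hy τ)).2]
  have hab : a + b - (2 * s) • 1 ∈ nullSpace A := by
    have := neg_mem (add_mem hya hyb)
    convert this using 1
    rw [two_mul, add_smul]
    abel
  have hs0 : 0 ≤ 2 * s := by linarith
  have h1 := CPEquiv.add_algebraMap_of_sub_mem (p := (a : A) + b) (n := algebraMap ℝ A (2 * s))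
    (add_nonneg ha hb) (algebraMap_nonneg A hs0) hab
    (by rw [AddSubgroup.coe_sub, AddSubgroup.coe_add, selfAdjoint.val_smul, selfAdjoint.val_one,
      Algebra.algebraMap_eq_smul_one]) (half_pos hε)
  rw [add_assoc, ← map_add] at h1
  -- Now `2s + ε/2 = a' + c` with both terms positive, so `0 ≤ a' ≤ 2s + ε/2` holds in `A` itself.
  -- Since `a'` is equivalent to `a`, the element `a' - s` represents the class of `y`, with norm at
  -- most `s + ε/2 = t + ε`.
  obtain ⟨a', c, haa', hc, hac⟩ := h1.exists_add_eq ha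
    (add_nonneg hb (algebraMap_nonneg A (half_pos hε).le))
  have ha'0 := haa'.nonneg_right
  have hc0 := hc.nonneg_right
  set a'' : selfAdjoint A := ⟨a', .of_nonneg ha'0⟩ with ha''
  have h2 : a - a'' ∈ nullSpace A := haa'.sub_mem_nullSpace _ rfl
  have h3 : (Submodule.Quotient.mk y : TraceQuotient A) =
      Submodule.Quotient.mk (a'' - s • 1) := by
    rw [Submodule.Quotient.eq]
    convert add_mem hya h2 using 1
    abel
  rw [h3]
  refine (Submodule.Quotient.norm_mk_le _ _).trans ?_
  refine norm_le_of_algebraMap_le (a'' - s • 1).2 (by linarith) ?_ ?_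
  · have : (((a'' - s • 1 : selfAdjoint A)) : A) = a' - algebraMap ℝ A s := by
      rw [AddSubgroup.coe_sub, selfAdjoint.val_smul, selfAdjoint.val_one,
        Algebra.algebraMap_eq_smul_one]
    rw [this, ← sub_nonneg]
    have e : a' - algebraMap ℝ A s - -algebraMap ℝ A (t + ε) = a' + algebraMap ℝ A (ε / 2) := by
      rw [hs, sub_neg_eq_add, sub_add_eq_add_sub, add_sub_assoc, ← map_sub]
      congr 2
      ring
    rw [e]
    exact add_nonneg ha'0 (algebraMap_nonneg A (half_pos hε).le)
  · have : (((a'' - s • 1 : selfAdjoint A)) : A) = a' - algebraMap ℝ A s := by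
      rw [AddSubgroup.coe_sub, selfAdjoint.val_smul, selfAdjoint.val_one,
        Algebra.algebraMap_eq_smul_one]
    rw [this, ← sub_nonneg]
    have e : algebraMap ℝ A (t + ε) - (a' - algebraMap ℝ A s) = c := by
      have : algebraMap ℝ A (t + ε) + algebraMap ℝ A s = a' + c := by
        rw [← hac, ← map_add]
        congr 1
        rw [hs]
        ring
      rw [sub_sub_eq_add_sub, this, add_sub_cancel_left]
    rw [e]
    exact hc0

lemma quotientTrace_ext {x y : TraceQuotient A} (h : ∀ τ, quotientTrace τ x = quotientTrace τ y) :
    x = y := by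
  rw [← sub_eq_zero, ← norm_le_zero_iff]
  exact norm_le_of_abs_quotientTrace_le le_rfl fun τ => by rw [map_sub, h, sub_self, abs_zero]

end Norm

/-! ### Continuous affine functions as elements of `A^q` -/

section Affine

open scoped ComplexStarModule

variable {A : Type*} [CStarAlgebra A]

lemma continuous_realTrace (x : selfAdjoint A) :
    Continuous fun τ : tracialStates A => realTrace τ x :=
  Complex.continuous_re.comp ((WeakDual.eval_continuous (x : A)).comp continuous_subtype_val)

lemma isClosed_tracialStates : IsClosed (tracialStates A) := by
  have h : tracialStates A = {τ | τ 1 = 1} ∩ ((⋂ a : A, {τ | 0 ≤ τ (star a * a)}) ∩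
      ⋂ a : A, ⋂ b : A, {τ | τ (a * b) = τ (b * a)}) := by
    ext τ
    simp [tracialStates]
  rw [h]
  refine (isClosed_eq (WeakDual.eval_continuous _) continuous_const).inter
    ((isClosed_iInter fun a => ?_).inter (isClosed_iInter fun a => isClosed_iInter fun b => ?_))
  · exact isClosed_le continuous_const (WeakDual.eval_continuous _)
  · exact isClosed_eq (WeakDual.eval_continuous _) (WeakDual.eval_continuous _)

variable [PartialOrder A] [StarOrderedRing A]

/-- Banach–Alaoglu. The crude bound `2` comes from adding the estimates for the real and imaginary
parts. -/
lemma isCompact_tracialStates : IsCompact (tracialStates A) := by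
  refine WeakDual.isCompact_of_bounded_of_closed ?_ isClosed_tracialStates
  refine WeakDual.isBounded_toWeakDual_preimage_iff_isBounded.1
    ((Metric.isBounded_closedBall (x := 0) (r := 2)).subset fun T hT => ?_)
  have h (x : selfAdjoint A) : ‖T x‖ ≤ ‖x‖ := by
    have h1 := coe_realTrace ⟨StrongDual.toWeakDual T, hT⟩ x
    change _ = T x at h1
    rw [← h1, Complex.norm_real]
    exact abs_realTrace_le _ x
  rw [mem_closedBall_zero_iff]
  refine ContinuousLinearMap.opNorm_le_bound _ zero_le_two fun a => ?_
  rw [← realPart_add_I_smul_imaginaryPart a, map_add, map_smul,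
    realPart_add_I_smul_imaginaryPart a]
  refine (norm_add_le _ _).trans ?_
  rw [norm_smul, Complex.norm_I, one_mul, two_mul]
  exact add_le_add ((h _).trans (realPart.norm_le a)) ((h _).trans (imaginaryPart.norm_le a))

instance compactSpace_tracialStates : CompactSpace (tracialStates A) :=
  isCompact_iff_compactSpace.1 isCompact_tracialStates

/-- A continuous linear functional on a product of lines is a finite combination of
coordinates. -/
lemma exists_finset_apply_eq_sum {ι : Type*} (φ : (ι → ℝ) →L[ℝ] ℝ) :
    ∃ (s : Finset ι) (c : ι → ℝ), ∀ v, φ v = ∑ i ∈ s, c i * v i := by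
  classical
  have h : φ ⁻¹' Metric.ball 0 1 ∈ 𝓝 (0 : ι → ℝ) :=
    φ.continuous.continuousAt.preimage_mem_nhds (by simpa using Metric.ball_mem_nhds 0 one_pos)
  rw [nhds_pi, Filter.mem_pi'] at h
  obtain ⟨s, t, ht, hts⟩ := h
  -- The neighbourhood restricts only the coordinates in `s`, so `φ` is bounded on the subspace
  -- where these vanish, hence zero there.
  have hzero : ∀ v : ι → ℝ, (∀ i ∈ s, v i = 0) → φ v = 0 := by
    intro v hv
    have hr : ∀ r : ℝ, |r * φ v| < 1 := fun r => by
      have : r • v ∈ φ ⁻¹' Metric.ball 0 1 := hts fun i hi => by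
        rw [Pi.smul_apply, hv i hi, smul_zero]
        exact mem_of_mem_nhds (ht i)
      simpa using this
    by_contra hne
    have := hr (φ v)⁻¹
    rw [inv_mul_cancel₀ hne, abs_one] at this
    exact lt_irrefl _ this
  refine ⟨s, fun i => φ (Pi.single i 1), fun v => ?_⟩
  have h0 := hzero (v - ∑ i ∈ s, v i • Pi.single i (1 : ℝ)) fun i hi => by
    simp [Finset.sum_apply, Pi.single_apply, hi]
  rw [map_sub, map_sum, sub_eq_zero] at h0
  rw [h0]
  exact Finset.sum_congr rfl fun i _ => by rw [map_smul, smul_eq_mul, mul_comm]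

/-- A continuous affine function on the tracial state space is approximated by evaluations at
self-adjoint elements. -/
lemma exists_abs_realTrace_sub_lt {f : tracialStates A → ℝ} (hf : Continuous f)
    (haff : ∀ (x y z : tracialStates A) (s t : ℝ), 0 ≤ s → 0 ≤ t → s + t = 1 →
      (z : WeakDual ℂ A) = s • (x : WeakDual ℂ A) + t • (y : WeakDual ℂ A) →
        f z = s * f x + t * f y) (hne : Nonempty (tracialStates A)) {ε : ℝ} (hε : 0 < ε) :
    ∃ x : selfAdjoint A, ∀ τ, |realTrace τ x - f τ| < ε := by
  -- `g r` is the graph of `f + r`, with a state embedded by its values on all self-adjoint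
  -- elements. The graphs for `0` and `ε` are disjoint, compact and convex.
  set g : ℝ → tracialStates A → (selfAdjoint A → ℝ) × ℝ := fun r τ => (realTrace τ, f τ + r)
    with hg
  have hgc : ∀ r, Continuous (g r) := fun r =>
    (continuous_pi fun x => continuous_realTrace x).prodMk (hf.add continuous_const)
  have hgconv : ∀ r, Convex ℝ (Set.range (g r)) := by
    rintro r _ ⟨σ, rfl⟩ _ ⟨τ, rfl⟩ s t hs ht hst
    refine ⟨⟨s • (σ : WeakDual ℂ A) + t • (τ : WeakDual ℂ A),
      convex_tracialStates σ.2 τ.2 hs ht hst⟩, Prod.ext (funext fun x => ?_) ?_⟩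
    · change (s • (σ : WeakDual ℂ A) x + t • (τ : WeakDual ℂ A) x).re = _
      simp [g, realTrace_apply]
    · simp only [g, Prod.snd_add, Prod.smul_snd, smul_eq_mul]
      rw [haff σ τ _ s t hs ht hst rfl]
      linear_combination (-r) * hst
  have hdisj : Disjoint (Set.range (g 0)) (Set.range (g ε)) := by
    rw [Set.disjoint_left]
    rintro _ ⟨σ, rfl⟩ ⟨τ, h⟩
    have h1 : τ = σ := realTrace_injective (DFunLike.coe_injective (congrArg Prod.fst h))
    have h2 := congrArg Prod.snd h
    simp only [g, h1] at h2
    linarith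
  obtain ⟨φ, u, v, hu, huv, hv⟩ := geometric_hahn_banach_compact_closed (hgconv 0)
    (isCompact_range (hgc 0)) (hgconv ε) (isCompact_range (hgc ε)).isClosed hdisj
  obtain ⟨s, c, hsc⟩ := exists_finset_apply_eq_sum (φ.comp (.inl ℝ (selfAdjoint A → ℝ) ℝ))
  set l := φ (0, 1) with hl
  set x : selfAdjoint A := ∑ i ∈ s, c i • i with hx
  have hφ : ∀ r τ, φ (g r τ) = realTrace τ x + (f τ + r) * l := by
    intro r τ
    have e : g r τ = (⇑(realTrace τ), 0) + (f τ + r) • ((0 : selfAdjoint A → ℝ), (1 : ℝ)) := by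
      simp [g]
    have e2 := hsc (realTrace τ)
    rw [e, map_add, map_smul, smul_eq_mul, hx, map_sum]
    simp only [map_smul, smul_eq_mul]
    rw [← e2]
    rfl
  have hu' : ∀ τ, realTrace τ x + f τ * l < u := fun τ => by
    have := hu _ ⟨τ, rfl⟩
    rwa [hφ, add_zero] at this
  have hv' : ∀ τ, v < realTrace τ x + (f τ + ε) * l := fun τ => by
    have := hv _ ⟨τ, rfl⟩
    rwa [hφ] at this
  have hl0 : 0 < l := by
    obtain ⟨τ⟩ := hne
    have h1 := hu' τ
    have h2 := hv' τ
    have : 0 < ε * l := by linarith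
    exact pos_of_mul_pos_right this hε.le
  -- Solve the hyperplane equation `τ(x) + l * f τ = u` for `f τ`. The two separation inequalities
  -- place `u - (τ(x) + l * f τ)` between `0` and `ε * l`.
  refine ⟨l⁻¹ • (u • 1 - x), fun τ => ?_⟩
  have hone : realTrace τ 1 = 1 := by
    rw [realTrace_apply, selfAdjoint.val_one, τ.2.1, Complex.one_re]
  rw [map_smul, map_sub, map_smul, hone, smul_eq_mul, smul_eq_mul, mul_one]
  have h1 := hu' τ
  have h2 := hv' τ
  have e : l⁻¹ * (u - realTrace τ x) - f τ = l⁻¹ * (u - (realTrace τ x + f τ * l)) := by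
    field_simp
    ring
  rw [e, abs_of_pos (mul_pos (inv_pos.2 hl0) (by linarith)), inv_mul_lt_iff₀ hl0]
  linarith

/-- Every continuous affine function on the tracial state space is evaluation at an element
of `A^q`. -/
lemma exists_quotientTrace_eq {f : tracialStates A → ℝ} (hf : Continuous f)
    (haff : ∀ (x y z : tracialStates A) (s t : ℝ), 0 ≤ s → 0 ≤ t → s + t = 1 →
      (z : WeakDual ℂ A) = s • (x : WeakDual ℂ A) + t • (y : WeakDual ℂ A) →
        f z = s * f x + t * f y) (hne : Nonempty (tracialStates A)) :
    ∃ x : TraceQuotient A, ∀ τ, quotientTrace τ x = f τ := by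
  have h : ∀ n : ℕ, ∃ x : TraceQuotient A, ∀ τ, |quotientTrace τ x - f τ| < 1 / ((n : ℝ) + 1) :=
    fun n => by
      obtain ⟨x, hx⟩ := exists_abs_realTrace_sub_lt hf haff hne (ε := 1 / ((n : ℝ) + 1))
        (by positivity)
      exact ⟨Submodule.Quotient.mk x, hx⟩
  choose x hx using h
  have h0 := tendsto_one_div_add_atTop_nhds_zero_nat (𝕜 := ℝ)
  -- Uniform closeness on traces controls the quotient norm, so the approximants converge in `A^q`.
  have hcau : CauchySeq x := by
    refine cauchySeq_of_le_tendsto_0 (fun N : ℕ => 2 * (1 / ((N : ℝ) + 1))) (fun n m N hn hm => ?_)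
      (by simpa using h0.const_mul 2)
    rw [dist_eq_norm]
    refine norm_le_of_abs_quotientTrace_le (by positivity) fun τ => ?_
    have h1 : 1 / ((n : ℝ) + 1) ≤ 1 / ((N : ℝ) + 1) := by gcongr
    have h2 : 1 / ((m : ℝ) + 1) ≤ 1 / ((N : ℝ) + 1) := by gcongr
    have h3 := abs_lt.1 (hx n τ)
    have h4 := abs_lt.1 (hx m τ)
    rw [map_sub, abs_le]
    constructor <;> linarith [h3.1, h3.2, h4.1, h4.2]
  obtain ⟨y, hy⟩ := cauchySeq_tendsto_of_complete hcau
  refine ⟨y, fun τ => ?_⟩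
  have h1 : Tendsto (fun n => quotientTrace τ (x n)) atTop (𝓝 (f τ)) := by
    rw [tendsto_iff_norm_sub_tendsto_zero]
    exact squeeze_zero (fun _ => norm_nonneg _) (fun n => (hx n τ).le) h0
  have h2 : Tendsto (fun n => quotientTrace τ (x n)) atTop (𝓝 (quotientTrace τ y)) := by
    rw [tendsto_iff_norm_sub_tendsto_zero] at hy ⊢
    refine squeeze_zero (fun _ => norm_nonneg _) (fun n => ?_) hy
    rw [← map_sub]
    exact abs_quotientTrace_le _ _
  exact tendsto_nhds_unique h2 h1

end Affine

/-! ### Transport along an affine homeomorphism -/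

section Isometry

variable {A B : Type*} [CStarAlgebra A] [CStarAlgebra B]

lemma IsAffineHomeo.symm {e : tracialStates A ≃ₜ tracialStates B} (he : IsAffineHomeo e) :
    IsAffineHomeo e.symm := by
  intro x y z s t hs ht hst h
  have h1 := he (e.symm x) (e.symm y) ⟨_, convex_tracialStates (e.symm x).2 (e.symm y).2 hs ht hst⟩
    s t hs ht hst rfl
  simp only [Homeomorph.apply_symm_apply] at h1
  rw [← h, ← Subtype.ext_iff] at h1
  rw [← h1, Homeomorph.symm_apply_apply]

variable [PartialOrder A] [StarOrderedRing A] [PartialOrder B] [StarOrderedRing B]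

lemma exists_quotientTrace_symm_eq (e : tracialStates A ≃ₜ tracialStates B)
    (he : IsAffineHomeo e) (hA : Nonempty (tracialStates A)) (y : TraceQuotient B) :
    ∃ x : TraceQuotient A, ∀ τ, quotientTrace τ x = quotientTrace (e τ) y := by
  obtain ⟨y, rfl⟩ := Submodule.Quotient.mk_surjective _ y
  refine exists_quotientTrace_eq (f := fun τ => realTrace (e τ) y)
    ((continuous_realTrace y).comp e.continuous) (fun σ τ υ s t hs ht hst h => ?_) hA
  have := he σ τ υ s t hs ht hst h
  rw [realTrace_apply, this]
  change (s • (e σ : WeakDual ℂ B) y + t • (e τ : WeakDual ℂ B) y).re = _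
  simp [realTrace_apply]

/-- An affine homeomorphism of tracial state spaces is induced by an isometric isomorphism of
the trace quotients. -/
lemma exists_linearIsometryEquiv (e : tracialStates A ≃ₜ tracialStates B)
    (he : IsAffineHomeo e) (hA : Nonempty (tracialStates A)) :
    ∃ Ψ : TraceQuotient A ≃ₗᵢ[ℝ] TraceQuotient B,
      ∀ τ x, quotientTrace (e τ) (Ψ x) = quotientTrace τ x := by
  -- Traces separate points of `A^q`, so these choices are forced; linearity and mutual inverseness
  -- are checked trace by trace.
  choose g hg using exists_quotientTrace_symm_eq e he hA
  choose f hf using exists_quotientTrace_symm_eq e.symm he.symm (hA.map e)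
  have hf' : ∀ x τ, quotientTrace (e τ) (f x) = quotientTrace τ x := fun x τ => by
    rw [hf, e.symm_apply_apply]
  let Φ : TraceQuotient A ≃ₗ[ℝ] TraceQuotient B :=
    { toFun := f
      invFun := g
      map_add' := fun x y => quotientTrace_ext fun τ => by rw [map_add, hf, hf, hf, map_add]
      map_smul' := fun r x => quotientTrace_ext fun τ => by
        rw [map_smul, hf, hf, map_smul, RingHom.id_apply]
      left_inv := fun x => quotientTrace_ext fun τ => by rw [hg, hf']
      right_inv := fun y => quotientTrace_ext fun τ => by rw [hf, hg, e.apply_symm_apply] }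
  refine ⟨⟨Φ, fun x => le_antisymm ?_ ?_⟩, fun τ x => hf' x τ⟩
  · refine norm_le_of_abs_quotientTrace_le (norm_nonneg _) fun τ => ?_
    change |quotientTrace τ (f x)| ≤ _
    rw [hf]
    exact abs_quotientTrace_le _ _
  · refine norm_le_of_abs_quotientTrace_le (norm_nonneg _) fun τ => ?_
    rw [← hf']
    exact abs_quotientTrace_le _ _

end Isometry

/-! ### Splitting off the unit in simple algebras -/

section Simple

variable {A : Type*} [CStarAlgebra A]

/-- In a simple C*-algebra the unit lies in the closure of the additive span of `A a A` for
nonzero `a`. -/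
lemma IsSimpleCStarAlgebra.one_mem_closure (hA : IsSimpleCStarAlgebra A) {a : A} (ha : a ≠ 0) :
    (1 : A) ∈ (AddSubmonoid.closure
      (Set.range fun p : A × A => p.1 * a * p.2)).topologicalClosure := by
  set S := AddSubmonoid.closure (Set.range fun p : A × A => p.1 * a * p.2) with hS
  have hleft : ∀ {x y : A}, y ∈ S.topologicalClosure → x * y ∈ S.topologicalClosure := by
    intro x y hy
    refine map_mem_closure (continuous_const_mul x) hy fun z hz => ?_
    induction hz using AddSubmonoid.closure_induction with
    | mem z hz =>
      obtain ⟨p, rfl⟩ := hz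
      exact AddSubmonoid.subset_closure ⟨(x * p.1, p.2), by simp [mul_assoc]⟩
    | zero => simp
    | add z w _ _ hz hw => simpa [mul_add] using S.add_mem hz hw
  have hright : ∀ {x y : A}, x ∈ S.topologicalClosure → x * y ∈ S.topologicalClosure := by
    intro x y hx
    refine map_mem_closure (f := (· * y)) (continuous_mul_const y) hx fun z hz => ?_
    induction hz using AddSubmonoid.closure_induction with
    | mem z hz =>
      obtain ⟨p, rfl⟩ := hz
      exact AddSubmonoid.subset_closure ⟨(p.1, p.2 * y), by simp [mul_assoc]⟩
    | zero => simp
    | add z w _ _ hz hw => simpa [add_mul] using S.add_mem hz hw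
  -- A submonoid suffices: negatives come from left multiplication by `-1`.
  let I : TwoSidedIdeal A := TwoSidedIdeal.mk' (S.topologicalClosure : Set A) (zero_mem _)
    (fun hx hy => add_mem hx hy) (fun {x} hx => by simpa using hleft (x := -1) hx) hleft hright
  have hI : ∀ x, x ∈ I ↔ x ∈ S.topologicalClosure := fun x => TwoSidedIdeal.mem_mk' ..
  have hIc : IsClosed (I : Set A) := by
    have : (I : Set A) = S.topologicalClosure := Set.ext hI
    rw [this]
    exact S.isClosed_topologicalClosure
  rw [← hI]
  rcases hA.2 I hIc with h | h
  · refine absurd ?_ ha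
    have : a ∈ I := (hI a).2 (subset_closure (AddSubmonoid.subset_closure ⟨(1, 1), by simp⟩))
    rwa [h, TwoSidedIdeal.mem_bot] at this
  · rw [h]
    trivial

variable [PartialOrder A] [StarOrderedRing A]

/-- The real part of an element of the additive span of `A a A` is dominated by an element
equivalent to one dominated by a multiple of `a`. -/
lemma exists_add_star_le_of_mem_closure {a : A} (ha : 0 ≤ a) {s : A}
    (hs : s ∈ AddSubmonoid.closure (Set.range fun p : A × A => p.1 * a * p.2)) :
    ∃ h k : A, s + star s ≤ h ∧ CPEquiv h k ∧ ∃ r : ℝ, 0 ≤ r ∧ k ≤ r • a := by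
  have hb : star (CFC.sqrt a) = CFC.sqrt a :=
    (IsSelfAdjoint.of_nonneg (CFC.sqrt_nonneg a)).star_eq
  have hbb : CFC.sqrt a * CFC.sqrt a = a := CFC.sqrt_mul_sqrt_self a
  have hgen : ∀ z : A, CPEquiv (z * a * star z) (CFC.sqrt a * (star z * z) * CFC.sqrt a) ∧
      CFC.sqrt a * (star z * z) * CFC.sqrt a ≤ ‖star z * z‖ • a := fun z => by
    constructor
    -- For `w = √a * star z`, `star w * w` is `z * a * star z`, while `w * star w` is dominated by a
    -- multiple of `a`.
    · have h := cpEquiv_star_mul_self (CFC.sqrt a * star z)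
      simp only [star_mul, star_star, hb] at h
      rw [← mul_assoc (z * CFC.sqrt a), mul_assoc z, hbb] at h
      rw [mul_assoc (CFC.sqrt a), mul_assoc]
      simpa only [mul_assoc] using h
    · have h := (IsSelfAdjoint.star_mul_self z).le_algebraMap_norm_self
      have h2 := star_left_conjugate_le_conjugate h (CFC.sqrt a)
      rw [hb, Algebra.algebraMap_eq_smul_one] at h2
      simpa [hbb] using h2
  induction hs using AddSubmonoid.closure_induction with
  | mem s hs =>
    obtain ⟨⟨x, y⟩, rfl⟩ := hs
    refine ⟨x * a * star x + star y * a * star (star y), _, ?_,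
      (hgen x).1.add (hgen (star y)).1,
      ‖star x * x‖ + ‖star (star y) * star y‖, by positivity, ?_⟩
    -- Expanding this square bounds the cross terms `x * a * y` plus adjoint by the diagonal ones.
    · have h := star_right_conjugate_nonneg ha (x - star y)
      rw [← sub_nonneg]
      convert h using 1
      simp only [star_mul, star_sub, star_star, (IsSelfAdjoint.of_nonneg ha).star_eq]
      noncomm_ring
    · rw [add_smul]
      exact add_le_add (hgen x).2 (hgen (star y)).2
  | zero => exact ⟨0, 0, by simp, CPEquiv.refl le_rfl, 0, le_rfl, by simp⟩
  | add s t _ _ hs ht =>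
    obtain ⟨h, k, h1, h2, r, hr, h3⟩ := hs
    obtain ⟨h', k', h1', h2', r', hr', h3'⟩ := ht
    refine ⟨h + h', k + k', ?_, h2.add h2', r + r', add_nonneg hr hr', ?_⟩
    · rw [star_add, add_add_add_comm]
      exact add_le_add h1 h1'
    · rw [add_smul]
      exact add_le_add h3 h3'

/-- In a simple C*-algebra every nonzero positive element dominates, up to equivalence, all small
multiples of the unit. -/
lemma IsSimpleCStarAlgebra.exists_cpEquiv_add_algebraMap (hA : IsSimpleCStarAlgebra A) {a : A}
    (ha : 0 ≤ a) (ha0 : a ≠ 0) :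
    ∃ δ : ℝ, 0 < δ ∧ ∀ ε, 0 < ε → ε ≤ δ → ∃ a' : A, 0 ≤ a' ∧
      CPEquiv a (a' + algebraMap ℝ A ε) := by
  -- Distance `1/2` gives `‖2 - s - star s‖ ≤ 1`, whence `s + star s ≥ 1`.
  obtain ⟨s, hs, hs1⟩ := Metric.mem_closure_iff.1 (hA.one_mem_closure ha0) (1 / 2) (by norm_num)
  obtain ⟨h, k, h1, h2, r, hr, h3⟩ := exists_add_star_le_of_mem_closure ha hs
  have h4 : 1 ≤ s + star s := by
    have hsa : IsSelfAdjoint ((1 - s) + star (1 - s)) := .add_star_self _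
    have hn : ‖(1 - s) + star (1 - s)‖ ≤ 1 := by
      refine (norm_add_le _ _).trans ?_
      rw [norm_star]
      rw [dist_eq_norm] at hs1
      linarith
    have h5 : (1 - s) + star (1 - s) ≤ 1 := by
      refine hsa.le_algebraMap_norm_self.trans ?_
      rw [← sub_nonneg]
      nth_rw 1 [← map_one (algebraMap ℝ A)]
      rw [← map_sub]
      exact algebraMap_nonneg A (sub_nonneg.2 hn)
    rw [← sub_nonneg] at h5 ⊢
    convert h5 using 1
    rw [star_sub, star_one]
    abel
  have h5 : 0 ≤ h - 1 := sub_nonneg.2 (h4.trans h1)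
  -- As `1 ≤ h` and `h` is equivalent to `k ≤ r • a`, Riesz decomposition makes the unit equivalent
  -- to some `c ≤ k`.
  obtain ⟨c, d, hc, hd, hcd⟩ := CPEquiv.exists_add_eq (h := (1 : A)) (k := h - 1) zero_le_one h5
    (by rwa [add_sub_cancel])
  have hcr : c ≤ (r + 1) • a := by
    refine le_trans ?_ (h3.trans ?_)
    · rw [hcd]
      exact le_add_of_nonneg_right hd.nonneg_right
    · rw [add_smul, one_smul]
      exact le_add_of_nonneg_right ha
  have hr1 : 0 < r + 1 := by linarith
  -- `r + 1` replaces `r` so that it is invertible even if `r = 0`. Then `ε • c ≤ a`, and in `a = (a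
  -- - ε • c) + ε • c` the last term is exchanged for `ε` times the unit.
  refine ⟨(r + 1)⁻¹, inv_pos.2 hr1, fun ε hε hεδ => ?_⟩
  have h6 : ε • c ≤ a := by
    have h7 : ε • c ≤ (r + 1)⁻¹ • c := by
      rw [← sub_nonneg, ← sub_smul]
      exact smul_nonneg (sub_nonneg.2 hεδ) hc.nonneg_right
    refine h7.trans ?_
    have := smul_le_smul_of_nonneg_left hcr (inv_pos.2 hr1).le
    rwa [smul_smul, inv_mul_cancel₀ hr1.ne', one_smul] at this
  refine ⟨a - ε • c, sub_nonneg.2 h6, ?_⟩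
  have := (CPEquiv.refl (sub_nonneg.2 h6)).add (hc.symm.smul hε.le)
  rwa [sub_add_cancel, ← Algebra.algebraMap_eq_smul_one] at this

/-- Every trace is at least `δ` on an element equivalent to a positive one plus `δ` times the unit.
-/
lemma IsSimpleCStarAlgebra.realTrace_pos (hA : IsSimpleCStarAlgebra A) {x : selfAdjoint A}
    (hx : 0 ≤ (x : A)) (hx0 : (x : A) ≠ 0) (τ : tracialStates A) : 0 < realTrace τ x := by
  obtain ⟨δ, hδ, h⟩ := hA.exists_cpEquiv_add_algebraMap hx hx0
  obtain ⟨a, ha, hxa⟩ := h δ hδ le_rfl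
  have h1 := (Complex.le_def.1 (apply_nonneg_of_mem_tracialStates τ.2 ha)).1
  rw [realTrace_apply, apply_eq_of_cpEquiv τ.2 hxa, map_add,
    apply_algebraMap_of_mem_tracialStates τ.2, Complex.add_re, Complex.ofReal_re]
  rw [Complex.zero_re] at h1
  linarith

/-- In a simple C*-algebra with a tracial state, positive elements congruent modulo `A₀` are
equivalent. -/
lemma IsSimpleCStarAlgebra.cpEquiv_of_sub_mem (hA : IsSimpleCStarAlgebra A)
    (τ : tracialStates A) {x y : selfAdjoint A} (hx : 0 ≤ (x : A)) (hy : 0 ≤ (y : A))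
    (hxy : x - y ∈ nullSpace A) : CPEquiv (x : A) y := by
  have hτ : realTrace τ x = realTrace τ y := by
    rw [← sub_eq_zero, ← map_sub, realTrace_eq_zero_of_mem hxy]
  have hiff : (x : A) = 0 ↔ (y : A) = 0 := by
    constructor <;> intro h <;> by_contra h'
    · have := hA.realTrace_pos hy h' τ
      rw [← hτ, realTrace_apply, h, map_zero, Complex.zero_re] at this
      exact lt_irrefl _ this
    · have := hA.realTrace_pos hx h' τ
      rw [hτ, realTrace_apply, h, map_zero, Complex.zero_re] at this
      exact lt_irrefl _ this
  by_cases hx0 : (x : A) = 0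
  · rw [hx0, hiff.1 hx0]
    exact CPEquiv.refl le_rfl
  obtain ⟨δ, hδ, h⟩ := hA.exists_cpEquiv_add_algebraMap hx hx0
  obtain ⟨δ', hδ', h'⟩ := hA.exists_cpEquiv_add_algebraMap hy (fun h => hx0 (hiff.2 h))
  set ε := min δ δ' with hε
  have hε0 : 0 < ε := lt_min hδ hδ'
  obtain ⟨a, ha, hxa⟩ := h ε hε0 (min_le_left _ _)
  obtain ⟨b, hb, hyb⟩ := h' ε hε0 (min_le_right _ _)
  have hu : (0 : A) ≤ algebraMap ℝ A ε := algebraMap_nonneg A hε0.le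
  set a' : selfAdjoint A := ⟨a, .of_nonneg ha⟩ with ha'
  set b' : selfAdjoint A := ⟨b, .of_nonneg hb⟩ with hb'
  set u : selfAdjoint A := ⟨algebraMap ℝ A ε, .of_nonneg hu⟩ with hu'
  have h1 : x - (a' + u) ∈ nullSpace A := hxa.sub_mem_nullSpace _ rfl
  have h2 : y - (b' + u) ∈ nullSpace A := hyb.sub_mem_nullSpace _ rfl
  -- Removing the common `ε` times the unit leaves congruent remainders; putting it back makes them
  -- equivalent.
  have h3 : a' - b' ∈ nullSpace A := by
    convert add_mem (sub_mem hxy h1) h2 using 1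
    abel
  exact hxa.trans ((CPEquiv.add_algebraMap_of_sub_mem ha hb h3 rfl hε0).trans hyb.symm)

end Simple

section Semigroup

variable {A B : Type*} [CStarAlgebra A] [PartialOrder A] [StarOrderedRing A]
  [CStarAlgebra B] [PartialOrder B] [StarOrderedRing B]

/-- A positive element as a self-adjoint element. -/
def toSelfAdjoint (a : {a : A // 0 ≤ a}) : selfAdjoint A := ⟨a, .of_nonneg a.2⟩

variable (A) in
/-- The canonical map from the Cuntz–Pedersen semigroup to `A^q`. -/
noncomputable def cpToQuotient : CPSemigroup A →ₙ+ TraceQuotient A where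
  toFun := Quotient.lift (fun a => Submodule.Quotient.mk (toSelfAdjoint a)) fun a b hab =>
    (Submodule.Quotient.eq _).2 (CPEquiv.sub_mem_nullSpace hab _ rfl)
  map_add' := by
    rintro ⟨a⟩ ⟨b⟩
    rfl

lemma IsSimpleCStarAlgebra.cpToQuotient_injective (hA : IsSimpleCStarAlgebra A)
    (τ : tracialStates A) : Function.Injective (cpToQuotient A) := by
  rintro ⟨a⟩ ⟨b⟩ h
  exact Quotient.sound (hA.cpEquiv_of_sub_mem τ (x := toSelfAdjoint a) (y := toSelfAdjoint b)
    a.2 b.2 ((Submodule.Quotient.eq _).1 h))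

/-- Faithfulness of traces gives one direction, Hahn–Banach positivity modulo `A₀` the other. The
criterion mentions only traces, so `Ψ` respects it. -/
lemma IsSimpleCStarAlgebra.mem_range_cpToQuotient (hA : IsSimpleCStarAlgebra A)
    (x : TraceQuotient A) :
    x ∈ Set.range (cpToQuotient A) ↔ x = 0 ∨ ∀ τ, 0 < quotientTrace τ x := by
  constructor
  · rintro ⟨⟨a⟩, rfl⟩
    by_cases ha : (a : A) = 0
    · left
      have : toSelfAdjoint a = 0 := Subtype.ext ha
      change Submodule.Quotient.mk (toSelfAdjoint a) = 0
      rw [this, Submodule.Quotient.mk_zero]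
    · exact Or.inr fun τ => hA.realTrace_pos (x := toSelfAdjoint a) a.2 ha τ
  · rintro (rfl | h)
    · refine ⟨((⟨0, le_rfl⟩ : {a : A // 0 ≤ a}) : CPSemigroup A), ?_⟩
      exact Submodule.Quotient.mk_zero _
    · obtain ⟨x, rfl⟩ := Submodule.Quotient.mk_surjective _ x
      obtain ⟨a, ha, hxa⟩ := exists_nonneg_sub_mem_nullSpace (x := x) h
      refine ⟨((⟨a, ha⟩ : {a : A // 0 ≤ a}) : CPSemigroup A), ?_⟩
      exact ((Submodule.Quotient.eq _).2 hxa).symm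

lemma nonempty_cpSemigroup_addEquiv (hA : IsSimpleCStarAlgebra A) (hB : IsSimpleCStarAlgebra B)
    (e : tracialStates A ≃ₜ tracialStates B) (hne : Nonempty (tracialStates A))
    (Ψ : TraceQuotient A ≃ₗᵢ[ℝ] TraceQuotient B)
    (hΨ : ∀ τ x, quotientTrace (e τ) (Ψ x) = quotientTrace τ x) :
    Nonempty (CPSemigroup A ≃+ CPSemigroup B) := by
  obtain ⟨τ⟩ := hne
  have hiff : ∀ x, Ψ x ∈ Set.range (cpToQuotient B) ↔ x ∈ Set.range (cpToQuotient A) := fun x => by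
    rw [hA.mem_range_cpToQuotient, hB.mem_range_cpToQuotient, e.surjective.forall]
    have h0 : Ψ x = 0 ↔ x = 0 := Ψ.toLinearEquiv.map_eq_zero_iff
    simp only [hΨ, h0]
  have hBi := hB.cpToQuotient_injective (e τ)
  -- The semigroup map is the restriction of `Ψ` to the embedded copies; additivity and bijectivity
  -- are inherited from `Ψ`.
  choose f hf using fun s => (hiff (cpToQuotient A s)).2 ⟨s, rfl⟩
  refine ⟨AddEquiv.ofBijective (⟨f, fun s t => hBi ?_⟩ : CPSemigroup A →ₙ+ CPSemigroup B)
    ⟨fun s t h => hA.cpToQuotient_injective τ (Ψ.injective ?_), fun t => ?_⟩⟩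
  · rw [hf, map_add, map_add, map_add, hf, hf]
  · rw [← hf, ← hf]
    exact congrArg _ h
  · obtain ⟨s, hs⟩ := (hiff (Ψ.symm (cpToQuotient B t))).1 (by simp)
    refine ⟨s, hBi ?_⟩
    change cpToQuotient B (f s) = _
    rw [hf, hs, Ψ.apply_symm_apply]

end Semigroup

end CuntzPedersen

theorem mainTheorem7 {A : Type*} {B : Type*}
    [CStarAlgebra A] [PartialOrder A] [StarOrderedRing A]
    [CStarAlgebra B] [PartialOrder B] [StarOrderedRing B]
    (hA : (CuntzPedersen.tracialStates A).Nonempty)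
    (hB : (CuntzPedersen.tracialStates B).Nonempty)
    (hAB : ∃ e : CuntzPedersen.tracialStates A ≃ₜ CuntzPedersen.tracialStates B,
      CuntzPedersen.IsAffineHomeo e) :
    Nonempty (CuntzPedersen.TraceQuotient A ≃L[ℝ] CuntzPedersen.TraceQuotient B) ∧
    (CuntzPedersen.IsSimpleCStarAlgebra A → CuntzPedersen.IsSimpleCStarAlgebra B →
      Nonempty (CuntzPedersen.CPSemigroup A ≃+ CuntzPedersen.CPSemigroup B)) := by
  obtain ⟨e, he⟩ := hAB
  obtain ⟨Ψ, hΨ⟩ := CuntzPedersen.exists_linearIsometryEquiv e he hA.to_subtype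
  exact ⟨⟨Ψ.toContinuousLinearEquiv⟩, fun hsA hsB =>
    CuntzPedersen.nonempty_cpSemigroup_addEquiv hsA hsB e hA.to_subtype Ψ hΨ⟩
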